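/- Let $K$ be a field that is complete with respect to a nontrivial non-archimedean absolute value, and assume $2\neq 0$ in $K$. (a) Let $t\in K$ with $|t|>1$, put $q=t^{-2}$, and let $E_q=\mathbf{G}_m/q^{\mathbf{Z}}$ be the Tate curve over $K$, with $E_q(K)=K^*/q^{\mathbf{Z}}$. There are exactly four points $P\in E_q(K)$ with $2P=0$, namely the classes of $1,-1,t,-t$. The quotient of $E_q$ by the inversion $z\mapsto z^{-1}$ exists and is $\mathbf{P}^1$; that is, there is an inversion-invariant analytic map $\pi:E_q\to\mathbf{P}^1$ over $K$ such that every inversion-invariant analytic map $E_q\to\mathbf{P}^1$ over $K$ is of the form $R\circ\pi$ with a rational function (possibly constant) $R:\mathbf{P}^1\to\mathbf{P}^1$ over $K$. For every such $\pi$, the points $\pi(1),\pi(-1),\pi(t),\pi(-t)$ of $\mathbf{P}^1(K)$ are pairwise distinct, and their cross ratio is $$\bigl(\pi(-t),\pi(t);\pi(1),\pi(-1)\bigr)=\lambda(t):=\left(\prod_{i\ge 0}\frac{t^{2i+1}+1}{t^{2i+1}-1}\right)^8,$$ where the infinite product converges and $(a,b;c,d)=\frac{(a-c)(b-d)}{(a-d)(b-c)}$.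 (In other words: if $\pi$ is normalised by $\pi(1)=0$, $\pi(-1)=\infty$, $\pi(t)=1$, then $\pi(-t)=\lambda(t)$.) (b) The function $\lambda$, with $\lambda(\infty)=1$, is a rigid analytic holomorphic function on the open disk $\{|t|>1\}\cup\{\infty\}$ around $\infty$ in $\mathbf{P}^1$: on each closed disk $\{|t|\ge\rho\}\cup\{\infty\}$ with $\rho>1$ it is a uniform limit of rational functions over $K$ without poles in that disk (poles and uniform convergence being considered on the points of the disk over an algebraic closure of $K$). -/

import Mathlib

open Filter Topology

/-- The `K`-points of the Tate curve `E_q = 𝔾_m / q^ℤ`, as a group. -/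
abbrev TateCurve {K : Type*} [Field K] (q : Kˣ) : Type _ :=
  Kˣ ⧸ Subgroup.zpowers q

/-- The point `[a : b]` of `ℙ¹(K) = K ∪ {∞}`, for `(a, b) ≠ (0, 0)`. -/
noncomputable def projPoint {K : Type*} [Field K] (a b : K) : OnePoint K :=
  open Classical in if b = 0 then OnePoint.infty else ((a / b : K) : OnePoint K)

/-- Homogeneous coordinates of a point of `ℙ¹(K) = K ∪ {∞}`. -/
def homCoord {K : Type*} [Field K] : OnePoint K → K × K
  | none => (1, 0)
  | some x => (x, 1)

/-- The determinant of the homogeneous coordinates of two points of `ℙ¹(K)`; for finite points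
it is the difference `x - y`. -/
def projDet {K : Type*} [Field K] (x y : OnePoint K) : K :=
  (homCoord x).1 * (homCoord y).2 - (homCoord y).1 * (homCoord x).2

/-- The cross ratio `(a, b; c, d) = (a - c)(b - d) / ((a - d)(b - c))` of points of `ℙ¹(K)`.
It is normalised by `(x, 1; 0, ∞) = x`. -/
noncomputable def crossRatio {K : Type*} [Field K] (a b c d : OnePoint K) : K :=
  (projDet a c * projDet b d) / (projDet a d * projDet b c)

/-- The map `ℙ¹(K) → ℙ¹(K)` given by the rational function `P / Q`, for coprime `P` and `Q`. -/
noncomputable def ratMap {K : Type*} [Field K] (P Q : Polynomial K) : OnePoint K → OnePoint K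
  | none => projPoint (P.coeff (max P.natDegree Q.natDegree)) (Q.coeff (max P.natDegree Q.natDegree))
  | some x => projPoint (P.eval x) (Q.eval x)

/-- Holomorphic functions on the rigid analytic `𝔾_m` over `K`: the two-sided Laurent series with
coefficients in `K` that converge everywhere. (`K` is nontrivially valued, so `Kˣ` has elements of
arbitrarily large and arbitrarily small absolute value, and convergence on `Kˣ` is convergence on
every annulus, also over extensions of `K`.) -/
def IsHolomorphicGm {K : Type*} [NontriviallyNormedField K] (f : Kˣ → K) : Prop :=
  ∃ a : ℤ → K, ∀ z : Kˣ, HasSum (fun n : ℤ => a n * ((z ^ n : Kˣ) : K)) (f z)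

/-- Analytic maps `E_q → ℙ¹` over `K`: the maps whose pull-back to `𝔾_m` is `[g : h]` with `g`, `h`
holomorphic on `𝔾_m` and without common zeros. The absence of common zeros (over all extensions of
`K`) is expressed by `g`, `h` generating the unit ideal of the ring of holomorphic functions. -/
def IsAnalyticToP1 {K : Type*} [NontriviallyNormedField K] {q : Kˣ}
    (f : TateCurve q → OnePoint K) : Prop :=
  ∃ g h : Kˣ → K, IsHolomorphicGm g ∧ IsHolomorphicGm h ∧
    (∃ a b : Kˣ → K, IsHolomorphicGm a ∧ IsHolomorphicGm b ∧ ∀ z, a z * g z + b z * h z = 1) ∧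
    ∀ z : Kˣ, f (QuotientGroup.mk z) = projPoint (g z) (h z)

/-- `π : E_q → ℙ¹` is the quotient map for the action of `{±1}` on the Tate curve `E_q` (with
nontrivial element `P ↦ P⁻¹`, in multiplicative notation): `π` is analytic and invariant, and every
invariant analytic map `E_q → ℙ¹` is a rational function of `π`. -/
def IsInversionQuotient {K : Type*} [NontriviallyNormedField K] {q : Kˣ}
    (π : TateCurve q → OnePoint K) : Prop :=
  IsAnalyticToP1 π ∧ (∀ P, π P⁻¹ = π P) ∧
    ∀ f : TateCurve q → OnePoint K, IsAnalyticToP1 f → (∀ P, f P⁻¹ = f P) →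
      ∃ A B : Polynomial K, IsCoprime A B ∧ ∀ P, f P = ratMap A B (π P)

/-- The factor with index `i` of the infinite product. -/
noncomputable def lambdaFactor {K : Type*} [Field K] (t : K) (i : ℕ) : K :=
  (t ^ (2 * i + 1) + 1) / (t ^ (2 * i + 1) - 1)

/-- The function `λ(t) = (∏_{i ≥ 0} (t^(2i+1) + 1) / (t^(2i+1) - 1))^8` on the disk `|t| > 1` around
`∞`; all factors have the value `1` at `t = ∞`. -/
noncomputable def tateLambda {K : Type*} [NontriviallyNormedField K] : OnePoint K → K
  | none => 1
  | some t => (∏' i : ℕ, lambdaFactor t i) ^ 8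

/-- The point of `ℙ¹(K)` with coordinate `w = 1/t`. -/
noncomputable def atInv {K : Type*} [Field K] (w : K) : OnePoint K := projPoint 1 w

/-- Rigid analytic holomorphic functions on the open disk `{|t| > 1} ∪ {∞}` of `ℙ¹`, in terms of the
coordinate `w = 1/t`: on each closed disk `|w| ≤ r`, `r < 1`, the function is a uniform limit of
rational functions `P n / Q n` over `K` without poles in this disk. The points of the closed disk
are taken in an algebraic closure of `K` (with the unique extension of the absolute value), both for
the poles and for the uniformity of the convergence; for algebraically closed `K` these are the
points of `K`. -/
def IsHolomorphicDiskAtInfty {K : Type*} [NontriviallyNormedField K] (f : OnePoint K → K) : Prop :=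
  ∀ r : ℝ, 0 < r → r < 1 → ∃ P Q : ℕ → Polynomial K,
    (∀ n, ∀ w : AlgebraicClosure K, spectralNorm K (AlgebraicClosure K) w ≤ r →
      Polynomial.aeval w (Q n) ≠ 0) ∧
    (∀ ε : ℝ, 0 < ε → ∃ N : ℕ, ∀ m n, N ≤ m → N ≤ n → ∀ w : AlgebraicClosure K,
      spectralNorm K (AlgebraicClosure K) w ≤ r →
        spectralNorm K (AlgebraicClosure K)
          (Polynomial.aeval w (P m) / Polynomial.aeval w (Q m)
            - Polynomial.aeval w (P n) / Polynomial.aeval w (Q n)) ≤ ε) ∧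
    ∀ w : K, ‖w‖ ≤ r →
      Tendsto (fun n => (P n).eval w / (Q n).eval w) atTop (𝓝 (f (atInv w)))

/-! Write `q = t⁻²`. The quotient map is made explicit as `[X : Y]`, where `X` = `thetaEven` and `Y`
= `thetaOdd` are symmetric theta functions on `𝔾_m`, holomorphic and invariant under inversion, both
multiplied by `q⁻¹ z⁻²` under `z ↦ q z`.

Universality. An analytic map on `E_q` is a pair `[g : h]` of holomorphic functions on `𝔾_m`
generating the unit ideal. A symmetry of `[g : h]` multiplies `g` and `h` by a common unit
(`exists_automorphy_factor`), and the units are the monomials `c zⁿ`. For an invariant map, the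
values of these monomials at `±1` (fixed by inversion) and at `±t` (where `q z = z⁻¹`) pin them
down, so that `g` and `h` may be taken to be symmetric theta functions of one degree `2e`
(`IsAnalyticToP1.exists_symmTheta`). Such a function is determined by `e + 1` Laurent coefficients,
and the `e + 1` monomials of degree `e` in `X`, `Y` are linearly independent; hence it is a binary
form in `X`, `Y` (`IsSymmTheta.exists_form`), and the map is a rational function of `[X : Y]`. That
`[X : Y]` is itself analytic requires an explicit Bézout identity (`exists_bezout_theta`).

Cross ratio. Two quotient maps are rational functions of each other, so they differ by a Möbius
transformation and the cross ratio may be computed for `[X : Y]`. Under `z ↦ -z`, `X` is even and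
`Y` is odd, while `X(t) = Y(1)` and `Y(t) = t X(1)`. With `X`, `Y` evaluated at `1`, the cross ratio
is therefore `((t X² + Y²) / (t X² - Y²))²`. Let `s = t⁻¹` and `θ(z) = ∑ s^(n²) zⁿ`. The duplication
formula `thetaSeries_sq` gives `t θ(±1)² = t X² ± Y²`, so the cross ratio is `(θ(1) / θ(-1))⁴`. The
triple product identity expresses `θ(1) / θ(-1)` as the square of `∏ (1 + s^(2i+1)) / (1 -
s^(2i+1))`, whence the exponent `8`.

Holomorphy of `λ`. In the coordinate `w = 1/t` the partial products have no poles for `|w| < 1`, and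
by the ultrametric inequality they converge uniformly on `|w| ≤ r < 1`.

Only points of `Kˣ` are available and the residue field may be finite, so the uniqueness of Laurent
coefficients (`laurent_coeff_eq_zero`) needs its own argument. Residue characteristic `2` is
allowed: `2` is only ever used as a nonzero element. -/

theorem HasSum.congr_terms {ι M : Type*} [AddCommMonoid M] [TopologicalSpace M] {f g : ι → M}
    {s : M} (h : HasSum f s) (hfg : ∀ i, f i = g i) : HasSum g s :=
  (funext hfg : f = g) ▸ h

/-! ### Sums over a non-archimedean field and dominant terms. -/

section Ultrametric

variable {K : Type*} [NontriviallyNormedField K] [IsUltrametricDist K] {ι : Type*}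

theorem HasSum.norm_lt_of_ultrametric {f : ι → K} {s : K} (hf : HasSum f s) {r : ℝ} (hr : 0 < r)
    (h : ∀ i, ‖f i‖ < r) : ‖s‖ < r := by
  have hc : IsClosed (Metric.ball (0 : K) r) := IsUltrametricDist.isClosed_ball _ _
  have : s ∈ Metric.ball (0 : K) r := by
    refine hc.mem_of_tendsto hf (Eventually.of_forall fun S => ?_)
    rw [mem_ball_zero_iff]
    rcases S.eq_empty_or_nonempty with rfl | hS
    · simpa using hr
    · obtain ⟨i, _, hi⟩ := IsUltrametricDist.exists_norm_finsetSum_le_of_nonempty hS f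
      exact hi.trans_lt (h i)
  simpa using this

theorem HasSum.norm_le_of_ultrametric {f : ι → K} {s : K} (hf : HasSum f s) {r : ℝ} (hr : 0 ≤ r)
    (h : ∀ i, ‖f i‖ ≤ r) : ‖s‖ ≤ r := by
  refine le_of_forall_gt fun x hx => hf.norm_lt_of_ultrametric (hr.trans_lt hx) fun i =>
    (h i).trans_lt hx

/-- A convergent sum with a strictly dominating term has the absolute value of that term. -/
theorem HasSum.norm_eq_of_dominant {f : ι → K} {s : K} (hf : HasSum f s) {i : ι} (hi : f i ≠ 0)
    (h : ∀ j, j ≠ i → ‖f j‖ < ‖f i‖) : ‖s‖ = ‖f i‖ := by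
  classical
  have h1 : HasSum (Function.update f i 0) (0 - f i + s) := hf.update i 0
  have h2 : ‖0 - f i + s‖ < ‖f i‖ := by
    refine h1.norm_lt_of_ultrametric (norm_pos_iff.2 hi) fun j => ?_
    by_cases hj : j = i
    · subst hj; simpa using hi
    · simpa [hj] using h j hj
  have h3 : ‖s‖ = max ‖0 - f i + s‖ ‖f i‖ := by
    have := IsUltrametricDist.norm_add_eq_max_of_norm_ne_norm h2.ne
    rwa [show 0 - f i + s + f i = s by ring] at this
  rw [h3, max_eq_right h2.le]

instance nonarchimedeanRing_of_isUltrametricDist : NonarchimedeanRing K where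
  is_nonarchimedean := NonarchimedeanAddGroup.is_nonarchimedean

theorem summable_iff_tendsto_cofinite [CompleteSpace K] {f : ι → K} :
    Summable f ↔ Tendsto f cofinite (𝓝 0) :=
  NonarchimedeanAddGroup.summable_iff_tendsto_cofinite_zero f

theorem Summable.of_norm_le_of_ultrametric [CompleteSpace K] {f g : ι → K} (hg : Summable g)
    (h : ∀ i, ‖f i‖ ≤ ‖g i‖) : Summable f := by
  rw [summable_iff_tendsto_cofinite] at *
  exact squeeze_zero_norm h (tendsto_zero_iff_norm_tendsto_zero.1 hg)

/-- Among terms tending to zero there is a largest one; among the largest ones, the last. -/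
theorem exists_last_dominant {w : ℤ → ℝ} (hw : Tendsto w cofinite (𝓝 0)) {k : ℤ} (hk : 0 < w k) :
    ∃ n, 0 < w n ∧ (∀ j, w j ≤ w n) ∧ ∀ j, n < j → w j < w n := by
  classical
  have hfin : {j | w k ≤ w j}.Finite := by
    have := hw.eventually (gt_mem_nhds hk)
    simpa only [Filter.eventually_cofinite, not_lt] using this
  obtain ⟨m, hm, hmax⟩ := hfin.exists_maximalFor w _ ⟨k, le_refl (w k)⟩
  have hmax' : ∀ j, w j ≤ w m := fun j => by
    by_cases hj : w k ≤ w j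
    · by_contra! hc
      exact absurd (hmax hj hc.le) (not_le.2 hc)
    · exact (not_le.1 hj).le.trans hm
  have hfin2 : {j | w j = w m}.Finite := hfin.subset fun j hj => by
    have : w j = w m := hj
    simpa [this] using hm
  obtain ⟨n, hn, hnmax⟩ := hfin2.exists_maximalFor id _ ⟨m, rfl⟩
  have hn' : w n = w m := hn
  refine ⟨n, hn' ▸ hk.trans_le hm, fun j => hn' ▸ hmax' j, fun j hj => ?_⟩
  refine lt_of_le_of_ne (hn' ▸ hmax' j) fun he => ?_
  exact absurd (hnmax (show j ∈ {j | w j = w m} from he.trans hn') hj.le) (not_le.2 hj)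

end Ultrametric

/-! ### Binomial expansion for integer exponents. -/

section IntegerPowers

/-- The coefficient of `y ^ k` in the expansion of `(1 + y) ^ n`. -/
def zchoose : ℤ → ℕ → ℤ
  | Int.ofNat n, k => n.choose k
  | Int.negSucc m, k => (-1) ^ k * (k + m).choose m

variable {K : Type*} [NontriviallyNormedField K]

theorem hasSum_zchoose (n : ℤ) {y : K} (hy : ‖y‖ < 1) :
    HasSum (fun k : ℕ => (zchoose n k : K) * y ^ k) ((1 + y) ^ n) := by
  rcases n with n | m
  · have h : (1 + y) ^ (Int.ofNat n) = ∑ k ∈ Finset.range (n + 1), ((n.choose k : ℕ) : K) * y ^ k := by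
      rw [Int.ofNat_eq_natCast, zpow_natCast, add_comm, add_pow]
      exact Finset.sum_congr rfl fun k _ => by simp [mul_comm]
    rw [h]
    have : HasSum (fun k : ℕ => (zchoose (Int.ofNat n) k : K) * y ^ k)
        (∑ k ∈ Finset.range (n + 1), (zchoose (Int.ofNat n) k : K) * y ^ k) :=
      hasSum_sum_of_ne_finset_zero fun k hk => by
        have : n < k := by simpa using hk
        simp [zchoose, Nat.choose_eq_zero_of_lt this]
    simpa [zchoose] using this
  · have := hasSum_choose_mul_geometric_of_norm_lt_one m (r := -y) (by simpa using hy)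
    rw [zpow_negSucc, ← one_div]
    rw [sub_neg_eq_add] at this
    convert this using 2 with k
    simp only [zchoose, neg_pow y k]
    push_cast
    ring

end IntegerPowers

/-! ### Uniqueness of Laurent coefficients on the points of `Kˣ`. -/

section Uniqueness

variable {K : Type*} [NontriviallyNormedField K] [IsUltrametricDist K] [CompleteSpace K]

/-- Generalized binomial coefficients are integers, hence of absolute value at most `1`. The double
series is thus dominated by `a n * y ^ k`, and the order of summation can be exchanged. -/
theorem hasSum_one_add_expansion {a : ℤ → K} (ha : Summable a) {y f : K} (hy : ‖y‖ < 1)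
    (hf : HasSum (fun n : ℤ => a n * (1 + y) ^ n) f) :
    HasSum (fun k : ℕ => (∑' n : ℤ, a n * (zchoose n k : K)) * y ^ k) f := by
  have hgeo : Summable fun k : ℕ => y ^ k := summable_geometric_of_norm_lt_one hy
  have hsum : Summable fun p : ℤ × ℕ => a p.1 * (zchoose p.1 p.2 : K) * y ^ p.2 := by
    refine (ha.mul_of_nonarchimedean hgeo).of_norm_le_of_ultrametric fun p => ?_
    rw [norm_mul, norm_mul, norm_mul]
    gcongr
    exact mul_le_of_le_one_right (norm_nonneg _) (IsUltrametricDist.norm_intCast_le_one K _)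
  have h1 : HasSum (fun p : ℤ × ℕ => a p.1 * (zchoose p.1 p.2 : K) * y ^ p.2) f := by
    have := hsum.hasSum.prod_fiberwise (g := fun n : ℤ => a n * (1 + y) ^ n) fun n => by
      simpa only [mul_assoc] using (hasSum_zchoose n hy).mul_left (a n)
    rw [hf.unique this]
    exact hsum.hasSum
  have h2 := (Equiv.prodComm ℕ ℤ).hasSum_iff.2 h1
  refine h2.prod_fiberwise fun k => ?_
  have : Summable fun n : ℤ => a n * (zchoose n k : K) :=
    ha.of_norm_le_of_ultrametric fun n => by
      rw [norm_mul]
      exact mul_le_of_le_one_right (norm_nonneg _) (IsUltrametricDist.norm_intCast_le_one K _)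
  exact this.hasSum.mul_right (y ^ k)

theorem tsum_mul_zchoose_eq_zero {a : ℤ → K} (ha : Summable a)
    (h : ∀ y : K, ‖y‖ < 1 → HasSum (fun n : ℤ => a n * (1 + y) ^ n) 0) (k : ℕ) :
    ∑' n : ℤ, a n * (zchoose n k : K) = 0 := by
  set c : ℕ → K := fun k => ∑' n : ℤ, a n * (zchoose n k : K) with hc
  have hp : HasFPowerSeriesAt (0 : K → K) (FormalMultilinearSeries.ofScalars K c) 0 := by
    rw [hasFPowerSeriesAt_iff]
    filter_upwards [Metric.ball_mem_nhds (0 : K) one_pos] with y hy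
    have := hasSum_one_add_expansion ha (mem_ball_zero_iff.1 hy) (h y (mem_ball_zero_iff.1 hy))
    simpa [FormalMultilinearSeries.coeff_ofScalars, hc, mul_comm] using this
  have h0 := hp.eq_zero
  have := congrArg (fun p => FormalMultilinearSeries.coeff p k) h0
  rw [FormalMultilinearSeries.coeff_ofScalars] at this
  rw [show ∑' n : ℤ, a n * (zchoose n k : K) = c k from rfl, this]
  simp [FormalMultilinearSeries.coeff]

/-- A two-sided Laurent series vanishing on the points of `Kˣ` vanishes. -/
theorem laurent_coeff_eq_zero {a : ℤ → K}
    (h : ∀ z : Kˣ, HasSum (fun n : ℤ => a n * ((z ^ n : Kˣ) : K)) 0) : a = 0 := by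
  by_contra hne
  obtain ⟨k, hk⟩ := Function.ne_iff.1 hne
  have ha : Summable a := by simpa using (h 1).summable
  have hw : Tendsto (fun n => ‖a n‖) cofinite (𝓝 0) :=
    tendsto_zero_iff_norm_tendsto_zero.1 (summable_iff_tendsto_cofinite.1 ha)
  obtain ⟨n, hn0, -, hlast⟩ := exists_last_dominant hw (norm_pos_iff.2 hk)
  -- All coefficients below `A` are strictly smaller than the last largest one, `a n`. After a shift
  -- by `A`, the coefficient of `y ^ (n - A)` in the expansion around `z = 1` is dominated by `a n`:
  -- negative indices carry small coefficients, indices from `0` to below `n - A` have binomial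
  -- coefficient `0`, and later ones are smaller because `n` is last.
  obtain ⟨A, hA⟩ : ∃ A : ℤ, A ≤ n ∧ ∀ j < A, ‖a j‖ < ‖a n‖ := by
    have := hw.eventually (gt_mem_nhds hn0)
    have hb := (Filter.eventually_cofinite.1 this).bddBelow
    obtain ⟨A, hA⟩ := hb
    refine ⟨min A n, min_le_right _ _, fun j hj => ?_⟩
    by_contra hc
    exact absurd (hA hc) (not_le.2 (hj.trans_le (min_le_left _ _)))
  obtain ⟨hAn, hA⟩ := hA
  obtain ⟨N, hN⟩ := Int.eq_ofNat_of_zero_le (sub_nonneg.2 hAn)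
  have hN' : n = N + A := by rw [← hN]; ring
  have hb : Summable fun m : ℤ => a (m + A) := (Equiv.addRight A).summable_iff.2 ha
  have hzero := tsum_mul_zchoose_eq_zero hb (fun y hy => ?_) N
  · have hs : Summable fun m : ℤ => a (m + A) * (zchoose m N : K) :=
      hb.of_norm_le_of_ultrametric fun n => by
        rw [norm_mul]
        exact mul_le_of_le_one_right (norm_nonneg _) (IsUltrametricDist.norm_intCast_le_one K _)
    have hN1 : a ((N : ℤ) + A) * (zchoose (N : ℤ) N : K) = a n := by
      change a ((N : ℤ) + A) * (((N.choose N : ℕ) : ℤ) : K) = a n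
      simp [hN']
    have hnorm := hs.hasSum.norm_eq_of_dominant (i := (N : ℤ))
      (by rw [hN1]; exact norm_pos_iff.1 hn0) fun j hj => ?_
    · rw [hzero, hN1, norm_zero] at hnorm
      exact hn0.ne hnorm
    · rw [hN1, norm_mul]
      rcases lt_or_ge j 0 with hj0 | hj0
      · refine (mul_le_of_le_one_right (norm_nonneg _)
          (IsUltrametricDist.norm_intCast_le_one K _)).trans_lt (hA _ (by linarith))
      · obtain ⟨i, rfl⟩ := Int.eq_ofNat_of_zero_le hj0
        rcases lt_or_gt_of_ne hj with hlt | hgt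
        · have : zchoose (i : ℤ) N = 0 := by
            change ((i.choose N : ℕ) : ℤ) = 0
            rw [Nat.choose_eq_zero_of_lt (by exact_mod_cast hlt)]; rfl
          simpa [this] using hn0
        · exact (mul_le_of_le_one_right (norm_nonneg _)
            (IsUltrametricDist.norm_intCast_le_one K _)).trans_lt (hlast _ (by linarith))
  · have hy1 : (1 + y) ≠ 0 := by
      intro h0
      have : y = -1 := by linear_combination h0
      simp [this] at hy
    have := h (Units.mk0 _ hy1)
    have h2 := ((Equiv.addRight A).hasSum_iff.2 this).mul_right ((1 + y) ^ (-A))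
    rw [zero_mul] at h2
    refine h2.congr_terms fun m => ?_
    simp only [Function.comp, Equiv.coe_addRight, Units.val_zpow_eq_zpow_val, Units.val_mk0]
    rw [mul_assoc, ← zpow_add₀ hy1]
    congr 3
    ring

end Uniqueness

/-! ### The ring of everywhere convergent Laurent series: it is a domain with monomial units. -/

section Laurent

variable {K : Type*} [NontriviallyNormedField K]

/-- `f` is the sum of the two-sided Laurent series with coefficients `a`, everywhere on `Kˣ`. -/
def IsLaurentSum (a : ℤ → K) (f : Kˣ → K) : Prop :=
  ∀ z : Kˣ, HasSum (fun n : ℤ => a n * ((z ^ n : Kˣ) : K)) (f z)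

theorem IsLaurentSum.isHolomorphicGm {a : ℤ → K} {f : Kˣ → K} (h : IsLaurentSum a f) :
    IsHolomorphicGm f :=
  ⟨a, h⟩

theorem IsLaurentSum.add {a b : ℤ → K} {f g : Kˣ → K} (hf : IsLaurentSum a f)
    (hg : IsLaurentSum b g) : IsLaurentSum (fun n => a n + b n) (fun z => f z + g z) :=
  fun z => ((hf z).add (hg z)).congr_terms fun n => by ring

theorem IsLaurentSum.const_mul {a : ℤ → K} {f : Kˣ → K} (c : K) (hf : IsLaurentSum a f) :
    IsLaurentSum (fun n => c * a n) (fun z => c * f z) :=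
  fun z => ((hf z).mul_left c).congr_terms fun n => by ring

theorem IsLaurentSum.sub {a b : ℤ → K} {f g : Kˣ → K} (hf : IsLaurentSum a f)
    (hg : IsLaurentSum b g) : IsLaurentSum (fun n => a n - b n) (fun z => f z - g z) :=
  fun z => ((hf z).sub (hg z)).congr_terms fun n => by ring

theorem IsLaurentSum.sum {ι : Type*} (s : Finset ι) {a : ι → ℤ → K} {f : ι → Kˣ → K}
    (h : ∀ i ∈ s, IsLaurentSum (a i) (f i)) :
    IsLaurentSum (fun n => ∑ i ∈ s, a i n) (fun z => ∑ i ∈ s, f i z) :=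
  fun z => (hasSum_sum fun i hi => h i hi z).congr_terms fun n => by rw [Finset.sum_mul]

theorem IsLaurentSum.comp_mul {a : ℤ → K} {f : Kˣ → K} (hf : IsLaurentSum a f) (c : Kˣ) :
    IsLaurentSum (fun n => a n * ((c ^ n : Kˣ) : K)) (fun z => f (c * z)) :=
  fun z => (hf (c * z)).congr_terms fun n => by rw [mul_zpow]; push_cast; ring

theorem IsLaurentSum.comp_inv {a : ℤ → K} {f : Kˣ → K} (hf : IsLaurentSum a f) :
    IsLaurentSum (fun n => a (-n)) (fun z => f z⁻¹) :=
  fun z => ((Equiv.neg ℤ).hasSum_iff.2 (hf z⁻¹)).congr_terms fun n => by simp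

theorem IsLaurentSum.zpow_mul {a : ℤ → K} {f : Kˣ → K} (hf : IsLaurentSum a f) (k : ℤ) :
    IsLaurentSum (fun n => a (n - k)) (fun z => ((z ^ k : Kˣ) : K) * f z) :=
  fun z => ((Equiv.subRight k).hasSum_iff.2 ((hf z).mul_left ((z ^ k : Kˣ) : K))).congr_terms
    fun n => by
      simp only [Function.comp, Equiv.subRight_apply]
      rw [mul_left_comm, ← Units.val_mul, ← zpow_add, add_sub_cancel]

theorem isLaurentSum_single (k : ℤ) (c : K) :
    IsLaurentSum (Pi.single k c) (fun z => c * ((z ^ k : Kˣ) : K)) := fun z => by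
  have := hasSum_single (f := fun n : ℤ => (Pi.single k c : ℤ → K) n * ((z ^ n : Kˣ) : K)) k
    fun n hn => by simp [Pi.single_eq_of_ne hn]
  simpa using this

theorem isLaurentSum_one : IsLaurentSum (Pi.single 0 1) (fun _ : Kˣ => (1 : K)) := by
  simpa using isLaurentSum_single (K := K) 0 1

theorem IsLaurentSum.eq_zero_of_coeff {f : Kˣ → K} (hf : IsLaurentSum 0 f) : f = 0 := by
  funext z
  exact (hf z).unique (by simp)

variable [IsUltrametricDist K]

/-- The reindexing of `ℤ × ℤ` by the sum and the first component. -/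
def intProdSumEquiv : ℤ × ℤ ≃ ℤ × ℤ where
  toFun p := (p.2, p.1 - p.2)
  invFun p := (p.1 + p.2, p.1)
  left_inv p := by simp
  right_inv p := by simp

theorem IsLaurentSum.hasSum_prod {a b : ℤ → K} {f g : Kˣ → K} (hf : IsLaurentSum a f)
    (hg : IsLaurentSum b g) (z : Kˣ) :
    HasSum (fun p : ℤ × ℤ => a p.2 * b (p.1 - p.2) * ((z ^ p.1 : Kˣ) : K)) (f z * g z) :=
  (intProdSumEquiv.hasSum_iff.2 ((hf z).mul_of_nonarchimedean (hg z))).congr_terms fun p => by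
    simp only [Function.comp, intProdSumEquiv, Equiv.coe_fn_mk]
    rw [show p.1 = p.2 + (p.1 - p.2) by ring, zpow_add, Units.val_mul]
    simp only [add_sub_cancel_left]
    ring

variable [CompleteSpace K]

theorem IsLaurentSum.coeff_unique {a b : ℤ → K} {f : Kˣ → K} (ha : IsLaurentSum a f)
    (hb : IsLaurentSum b f) : a = b := by
  have := laurent_coeff_eq_zero (a := fun n => a n - b n) fun z => by
    simpa using (ha.sub hb) z
  funext n
  exact sub_eq_zero.1 (congrFun this n)

theorem IsLaurentSum.tendsto_norm {a : ℤ → K} {f : Kˣ → K} (ha : IsLaurentSum a f) {r : ℝ}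
    (hr : 0 < r) : Tendsto (fun n : ℤ => ‖a n‖ * r ^ n) cofinite (𝓝 0) := by
  obtain ⟨x, hx⟩ := NormedField.exists_lt_norm K r
  obtain ⟨y, hy0, hy⟩ := NormedField.exists_norm_lt K hr
  have hx0 : 0 < ‖x‖ := hr.trans hx
  have key : ∀ z : K, ∀ hz : z ≠ 0, Tendsto (fun n : ℤ => ‖a n‖ * ‖z‖ ^ n) cofinite (𝓝 0) := by
    intro z hz
    have := tendsto_zero_iff_norm_tendsto_zero.1
      (summable_iff_tendsto_cofinite.1 (ha (Units.mk0 z hz)).summable)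
    simpa [Units.val_zpow_eq_zpow_val] using this
  have h1 := (key x (norm_pos_iff.1 hx0)).add (key y (norm_pos_iff.1 hy0))
  rw [add_zero] at h1
  refine squeeze_zero (fun n => by positivity) (fun n => ?_) h1
  rw [← mul_add]
  gcongr
  rcases le_total 0 n with hn | hn
  · have : r ^ n ≤ ‖x‖ ^ n := zpow_le_zpow_left₀ hn hr.le hx.le
    have : 0 < ‖y‖ ^ n := zpow_pos hy0 n
    linarith
  · have : r ^ n ≤ ‖y‖ ^ n := by
      rw [← neg_neg n, zpow_neg, zpow_neg ‖y‖]
      exact inv_anti₀ (zpow_pos hy0 _) (zpow_le_zpow_left₀ (by linarith) hy0.le hy.le)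
    have : 0 < ‖x‖ ^ n := zpow_pos hx0 n
    linarith

/-- The coefficients of a product of Laurent series. -/
noncomputable def laurentConv (a b : ℤ → K) (n : ℤ) : K := ∑' i : ℤ, a i * b (n - i)

theorem IsLaurentSum.hasSum_laurentConv {a b : ℤ → K} {f g : Kˣ → K} (hf : IsLaurentSum a f)
    (hg : IsLaurentSum b g) (n : ℤ) :
    HasSum (fun i : ℤ => a i * b (n - i)) (laurentConv a b n) := by
  have := (hf.hasSum_prod hg 1).summable.prod_factor n
  simp only [one_zpow, Units.val_one, mul_one] at this
  exact this.hasSum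

theorem IsLaurentSum.mul {a b : ℤ → K} {f g : Kˣ → K} (hf : IsLaurentSum a f)
    (hg : IsLaurentSum b g) : IsLaurentSum (laurentConv a b) (fun z => f z * g z) :=
  fun z => (hf.hasSum_prod hg z).prod_fiberwise fun n =>
    (hf.hasSum_laurentConv hg n).mul_right _

theorem IsLaurentSum.norm_laurentConv_of_dominant {a b : ℤ → K} {f g : Kˣ → K}
    (hf : IsLaurentSum a f) (hg : IsLaurentSum b g) {r : ℝ} (hr : 0 < r) {n m : ℤ}
    (hn : 0 < ‖a n‖ * r ^ n) (hm : 0 < ‖b m‖ * r ^ m)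
    (hn1 : ∀ j, ‖a j‖ * r ^ j ≤ ‖a n‖ * r ^ n) (hn2 : ∀ j, n < j → ‖a j‖ * r ^ j < ‖a n‖ * r ^ n)
    (hm1 : ∀ j, ‖b j‖ * r ^ j ≤ ‖b m‖ * r ^ m) (hm2 : ∀ j, m < j → ‖b j‖ * r ^ j < ‖b m‖ * r ^ m) :
    ‖laurentConv a b (n + m)‖ = ‖a n‖ * ‖b m‖ := by
  have ha0 : a n ≠ 0 := fun h => by simp [h] at hn
  have hb0 : b m ≠ 0 := fun h => by simp [h] at hm
  have := (hf.hasSum_laurentConv hg (n + m)).norm_eq_of_dominant (i := n) (by simp [ha0, hb0])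
    fun i hi => ?_
  · simpa using this
  · simp only [add_sub_cancel_left, norm_mul]
    have hpos : 0 < r ^ (n + m) := zpow_pos hr _
    refine lt_of_mul_lt_mul_right ?_ hpos.le
    have e1 : ‖a i‖ * ‖b (n + m - i)‖ * r ^ (n + m) =
        (‖a i‖ * r ^ i) * (‖b (n + m - i)‖ * r ^ (n + m - i)) := by
      rw [show n + m = i + (n + m - i) by ring, zpow_add₀ hr.ne']
      simp only [add_sub_cancel_left]
      ring
    have e2 : ‖a n‖ * ‖b m‖ * r ^ (n + m) = (‖a n‖ * r ^ n) * (‖b m‖ * r ^ m) := by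
      rw [zpow_add₀ hr.ne']; ring
    rw [e1, e2]
    rcases lt_or_gt_of_ne hi with h | h
    · exact mul_lt_mul' (hn1 i) (hm2 _ (by linarith)) (by positivity) hn
    · exact (mul_le_mul_of_nonneg_left (hm1 _) (by positivity)).trans_lt
        (mul_lt_mul_of_pos_right (hn2 i h) hm)

theorem IsLaurentSum.exists_dominant {a : ℤ → K} {f : Kˣ → K} (hf : IsLaurentSum a f)
    (ha : a ≠ 0) {r : ℝ} (hr : 0 < r) :
    ∃ n, 0 < ‖a n‖ * r ^ n ∧ (∀ j, ‖a j‖ * r ^ j ≤ ‖a n‖ * r ^ n) ∧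
      ∀ j, n < j → ‖a j‖ * r ^ j < ‖a n‖ * r ^ n := by
  obtain ⟨k, hk⟩ := Function.ne_iff.1 ha
  exact exists_last_dominant (hf.tendsto_norm hr) (k := k)
    (mul_pos (norm_pos_iff.2 hk) (zpow_pos hr k))

/-- The ring of holomorphic functions on `𝔾_m` is a domain. -/
theorem IsHolomorphicGm.eq_zero_or_eq_zero_of_mul {f g : Kˣ → K} (hf : IsHolomorphicGm f)
    (hg : IsHolomorphicGm g) (h : ∀ z, f z * g z = 0) : f = 0 ∨ g = 0 := by
  obtain ⟨a, ha : IsLaurentSum a f⟩ := hf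
  obtain ⟨b, hb : IsLaurentSum b g⟩ := hg
  have hz : laurentConv a b = 0 := laurent_coeff_eq_zero fun z => by
    simpa [h z] using (ha.mul hb) z
  by_cases ha0 : a = 0
  · subst ha0; exact Or.inl ha.eq_zero_of_coeff
  by_cases hb0 : b = 0
  · subst hb0; exact Or.inr hb.eq_zero_of_coeff
  exfalso
  obtain ⟨n, hn, hn1, hn2⟩ := ha.exists_dominant ha0 one_pos
  obtain ⟨m, hm, hm1, hm2⟩ := hb.exists_dominant hb0 one_pos
  have := ha.norm_laurentConv_of_dominant hb one_pos hn hm hn1 hn2 hm1 hm2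
  rw [hz, Pi.zero_apply, norm_zero] at this
  simp only [one_zpow, mul_one] at hn hm
  exact (mul_pos hn hm).ne this

/-- The units of the ring of holomorphic functions on `𝔾_m` are the monomials. -/
theorem IsHolomorphicGm.exists_monomial_of_mul_eq_one {f g : Kˣ → K} (hf : IsHolomorphicGm f)
    (hg : IsHolomorphicGm g) (h : ∀ z, f z * g z = 1) :
    ∃ (c : K) (n : ℤ), c ≠ 0 ∧ ∀ z : Kˣ, f z = c * ((z ^ n : Kˣ) : K) := by
  obtain ⟨a, ha : IsLaurentSum a f⟩ := hf
  obtain ⟨b, hb : IsLaurentSum b g⟩ := hg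
  have hone : laurentConv a b = Pi.single 0 1 := by
    refine (ha.mul hb).coeff_unique ?_
    simpa only [h] using isLaurentSum_one (K := K)
  have ha0 : a ≠ 0 := by
    rintro rfl
    have := h 1
    simp [ha.eq_zero_of_coeff] at this
  have hb0 : b ≠ 0 := by
    rintro rfl
    have := h 1
    simp [hb.eq_zero_of_coeff] at this
  -- On each circle `|z| = r` the last dominant terms of the two factors multiply to the dominant
  -- term of the product `1`, so their indices are opposite.
  have key : ∀ r : ℝ, 0 < r → ∃ n : ℤ, ‖a n‖ * ‖b (-n)‖ = 1 ∧
      (∀ j, ‖a j‖ * r ^ j ≤ ‖a n‖ * r ^ n) ∧ ∀ j, ‖b j‖ * r ^ j ≤ ‖b (-n)‖ * r ^ (-n) := by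
    intro r hr
    obtain ⟨n, hn, hn1, hn2⟩ := ha.exists_dominant ha0 hr
    obtain ⟨m, hm, hm1, hm2⟩ := hb.exists_dominant hb0 hr
    have hd := ha.norm_laurentConv_of_dominant hb hr hn hm hn1 hn2 hm1 hm2
    have hpos : 0 < ‖a n‖ * ‖b m‖ :=
      mul_pos (pos_of_mul_pos_left hn (zpow_pos hr _).le) (pos_of_mul_pos_left hm (zpow_pos hr _).le)
    rw [hone] at hd
    have hnm : n + m = 0 := by
      by_contra hne
      rw [Pi.single_eq_of_ne hne, norm_zero] at hd
      exact hpos.ne hd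
    obtain rfl : m = -n := by linarith
    refine ⟨n, ?_, hn1, hm1⟩
    simpa using hd.symm
  obtain ⟨n, hn, -, -⟩ := key 1 one_pos
  have han : 0 < ‖a n‖ := by
    rcases (norm_nonneg (a n)).eq_or_lt with h0 | h0
    · simp [← h0] at hn
    · exact h0
  -- The index found for `r = 1` is dominant for every `r`: passing to the dominant index `k` can
  -- only increase both factors, yet both products equal `1`. Letting `r` be large or small then
  -- kills all other coefficients.
  have hdom : ∀ r : ℝ, 0 < r → ∀ j, ‖a j‖ * r ^ j ≤ ‖a n‖ * r ^ n := by
    intro r hr j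
    obtain ⟨k, hk, hk1, hk2⟩ := key r hr
    have hrn : 0 < r ^ n := zpow_pos hr n
    have hrk : 0 < r ^ k := zpow_pos hr k
    have h1 := hk1 n
    have h2 := hk2 (-n)
    rw [zpow_neg, zpow_neg] at h2
    have hbk : 0 < ‖b (-k)‖ * (r ^ k)⁻¹ := by
      have : 0 < ‖b (-k)‖ := by
        rcases (norm_nonneg (b (-k))).eq_or_lt with h0 | h0
        · simp [← h0] at hk
        · exact h0
      positivity
    have e1 : (‖a n‖ * r ^ n) * (‖b (-n)‖ * (r ^ n)⁻¹) = 1 := by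
      rw [← hn]; field_simp
    have e2 : (‖a k‖ * r ^ k) * (‖b (-k)‖ * (r ^ k)⁻¹) = 1 := by
      rw [← hk]; field_simp
    have : ‖a k‖ * r ^ k ≤ ‖a n‖ * r ^ n := by
      refine le_of_mul_le_mul_right ?_ hbk
      rw [e2, ← e1]
      gcongr
    exact (hk1 j).trans this
  have hsingle : a = Pi.single n (a n) := by
    funext j
    by_cases hj : j = n
    · subst hj; simp
    rw [Pi.single_eq_of_ne hj]
    by_contra hne
    have haj : 0 < ‖a j‖ := norm_pos_iff.2 hne
    have hle : ∀ r : ℝ, 0 < r → r ^ (j - n) ≤ ‖a n‖ / ‖a j‖ := by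
      intro r hr
      rw [le_div_iff₀ haj, zpow_sub₀ hr.ne', div_mul_eq_mul_div, div_le_iff₀ (zpow_pos hr n)]
      linarith [hdom r hr j]
    set C := ‖a n‖ / ‖a j‖ with hC
    have hC0 : 0 < C := by positivity
    have hgt : C < C + 1 := by linarith
    rcases lt_or_gt_of_ne hj with hlt | hlt
    · have h1 := hle (C + 1)⁻¹ (by positivity)
      rw [inv_zpow, ← zpow_neg, neg_sub] at h1
      have h2 : (C + 1) ^ (1 : ℤ) ≤ (C + 1) ^ (n - j) :=
        zpow_le_zpow_right₀ (by linarith) (by linarith)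
      rw [zpow_one] at h2
      linarith
    · have h1 := hle (C + 1) (by positivity)
      have h2 : (C + 1) ^ (1 : ℤ) ≤ (C + 1) ^ (j - n) :=
        zpow_le_zpow_right₀ (by linarith) (by linarith)
      rw [zpow_one] at h2
      linarith
  refine ⟨a n, n, norm_pos_iff.1 han, fun z => ?_⟩
  have h1 := ha z
  rw [hsingle] at h1
  simpa using h1.unique (isLaurentSum_single n (a n) z)

end Laurent

/-! ### Closure properties of holomorphic functions on `𝔾_m`. -/

section Holomorphic

variable {K : Type*} [NontriviallyNormedField K]

namespace IsHolomorphicGm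

theorem const (c : K) : IsHolomorphicGm (fun _ : Kˣ => c) := by
  have := (isLaurentSum_single 0 c).isHolomorphicGm
  simpa only [zpow_zero, Units.val_one, mul_one] using this

theorem add {f g : Kˣ → K} (hf : IsHolomorphicGm f) (hg : IsHolomorphicGm g) :
    IsHolomorphicGm (fun z => f z + g z) :=
  let ⟨_, ha⟩ := hf; let ⟨_, hb⟩ := hg; ⟨_, IsLaurentSum.add ha hb⟩

theorem sub {f g : Kˣ → K} (hf : IsHolomorphicGm f) (hg : IsHolomorphicGm g) :
    IsHolomorphicGm (fun z => f z - g z) :=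
  let ⟨_, ha⟩ := hf; let ⟨_, hb⟩ := hg; ⟨_, IsLaurentSum.sub ha hb⟩

theorem const_mul {f : Kˣ → K} (c : K) (hf : IsHolomorphicGm f) :
    IsHolomorphicGm (fun z => c * f z) :=
  let ⟨_, ha⟩ := hf; ⟨_, IsLaurentSum.const_mul c ha⟩

theorem comp_mul {f : Kˣ → K} (hf : IsHolomorphicGm f) (c : Kˣ) :
    IsHolomorphicGm (fun z => f (c * z)) :=
  let ⟨_, ha⟩ := hf; ⟨_, IsLaurentSum.comp_mul ha c⟩

theorem comp_inv {f : Kˣ → K} (hf : IsHolomorphicGm f) : IsHolomorphicGm (fun z => f z⁻¹) :=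
  let ⟨_, ha⟩ := hf; ⟨_, IsLaurentSum.comp_inv ha⟩

theorem zpow_mul {f : Kˣ → K} (hf : IsHolomorphicGm f) (k : ℤ) :
    IsHolomorphicGm (fun z => ((z ^ k : Kˣ) : K) * f z) :=
  let ⟨_, ha⟩ := hf; ⟨_, IsLaurentSum.zpow_mul ha k⟩

variable [IsUltrametricDist K] [CompleteSpace K]

theorem mul {f g : Kˣ → K} (hf : IsHolomorphicGm f) (hg : IsHolomorphicGm g) :
    IsHolomorphicGm (fun z => f z * g z) :=
  let ⟨_, ha⟩ := hf; let ⟨_, hb⟩ := hg; ⟨_, IsLaurentSum.mul ha hb⟩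

end IsHolomorphicGm

end Holomorphic

/-! ### Homogeneous coordinates and cross ratios. -/

section ProjectiveLine

variable {K : Type*} [Field K]

theorem projPoint_mul {c : K} (hc : c ≠ 0) (a b : K) :
    projPoint (c * a) (c * b) = projPoint a b := by
  unfold projPoint
  by_cases hb : b = 0
  · simp [hb]
  · simp [hb, hc, mul_div_mul_left]

theorem projPoint_eq_iff {a b c d : K} (hab : a ≠ 0 ∨ b ≠ 0) (hcd : c ≠ 0 ∨ d ≠ 0) :
    projPoint a b = projPoint c d ↔ a * d = c * b := by
  unfold projPoint
  by_cases hb : b = 0 <;> by_cases hd : d = 0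
  · simp [hb, hd]
  · have ha : a ≠ 0 := by simpa [hb] using hab
    simp [hb, hd, ha]
  · have hc : c ≠ 0 := by simpa [hd] using hcd
    simp [hb, hd, hc]
  · simp only [hb, hd, if_false]
    rw [OnePoint.coe_eq_coe, div_eq_div_iff hb hd]

theorem exists_homCoord_projPoint {a b : K} (hab : a ≠ 0 ∨ b ≠ 0) :
    ∃ c : K, c ≠ 0 ∧ homCoord (projPoint a b) = (c * a, c * b) := by
  unfold projPoint
  by_cases hb : b = 0
  · have ha : a ≠ 0 := by simpa [hb] using hab
    refine ⟨a⁻¹, inv_ne_zero ha, ?_⟩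
    simp only [hb, if_true, inv_mul_cancel₀ ha, mul_zero]
    rfl
  · refine ⟨b⁻¹, inv_ne_zero hb, ?_⟩
    simp only [hb, if_false, inv_mul_cancel₀ hb, inv_mul_eq_div]
    rfl

theorem exists_projPoint (x : OnePoint K) : ∃ a b : K, (a ≠ 0 ∨ b ≠ 0) ∧ x = projPoint a b := by
  induction x using OnePoint.rec with
  | infty => exact ⟨1, 0, by simp, by simp [projPoint]⟩
  | coe x => exact ⟨x, 1, by simp, by simp [projPoint]⟩

theorem crossRatio_projPoint {a₁ a₂ b₁ b₂ c₁ c₂ d₁ d₂ : K} (ha : a₁ ≠ 0 ∨ a₂ ≠ 0)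
    (hb : b₁ ≠ 0 ∨ b₂ ≠ 0) (hc : c₁ ≠ 0 ∨ c₂ ≠ 0) (hd : d₁ ≠ 0 ∨ d₂ ≠ 0) :
    crossRatio (projPoint a₁ a₂) (projPoint b₁ b₂) (projPoint c₁ c₂) (projPoint d₁ d₂) =
      ((a₁ * c₂ - c₁ * a₂) * (b₁ * d₂ - d₁ * b₂)) /
        ((a₁ * d₂ - d₁ * a₂) * (b₁ * c₂ - c₁ * b₂)) := by
  obtain ⟨u, hu, eu⟩ := exists_homCoord_projPoint ha
  obtain ⟨v, hv, ev⟩ := exists_homCoord_projPoint hb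
  obtain ⟨w, hw, ew⟩ := exists_homCoord_projPoint hc
  obtain ⟨x, hx, ex⟩ := exists_homCoord_projPoint hd
  simp only [crossRatio, projDet, eu, ev, ew, ex]
  have h0 : u * v * w * x ≠ 0 := by positivity
  rw [← mul_div_mul_left ((a₁ * c₂ - c₁ * a₂) * (b₁ * d₂ - d₁ * b₂)) _ h0]
  congr 1 <;> ring

end ProjectiveLine

/-! ### Factors of automorphy of invariant maps. -/

section Automorphy

variable {K : Type*} [NontriviallyNormedField K]

/-- Symmetric theta functions of degree `2e` on `𝔾_m`: holomorphic functions invariant under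
inversion with `f (q z) = q ^ (-e) z ^ (-2e) f z`. -/
structure IsSymmTheta (q : Kˣ) (e : ℤ) (f : Kˣ → K) : Prop where
  holomorphic : IsHolomorphicGm f
  inv : ∀ z, f z⁻¹ = f z
  shift : ∀ z, f (q * z) = ((q ^ (-e) * z ^ (-2 * e) : Kˣ) : K) * f z

variable [IsUltrametricDist K] [CompleteSpace K]

/-- If `[g : h]` is invariant under the transformation `σ`, then `g` and `h` are multiplied by the
same unit under `σ`. -/
theorem exists_automorphy_factor {g h a b : Kˣ → K} (hg : IsHolomorphicGm g)
    (hh : IsHolomorphicGm h) (ha : IsHolomorphicGm a) (hb : IsHolomorphicGm b)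
    (hab : ∀ z, a z * g z + b z * h z = 1) {σ : Kˣ → Kˣ}
    (hσ : ∀ f : Kˣ → K, IsHolomorphicGm f → IsHolomorphicGm (fun z => f (σ z)))
    (hinv : ∀ z, projPoint (g (σ z)) (h (σ z)) = projPoint (g z) (h z)) :
    ∃ (c : K) (n : ℤ), c ≠ 0 ∧ ∀ z, g (σ z) = c * ((z ^ n : Kˣ) : K) * g z ∧
      h (σ z) = c * ((z ^ n : Kˣ) : K) * h z := by
  have hne : ∀ z, g z ≠ 0 ∨ h z ≠ 0 := fun z => by
    by_contra! h0
    have := hab z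
    simp [h0.1, h0.2] at this
  have hx : ∀ z, g (σ z) * h z = g z * h (σ z) := fun z =>
    (projPoint_eq_iff (hne _) (hne _)).1 (hinv z)
  -- The Bézout coefficients turn the quotient `g ∘ σ / g = h ∘ σ / h` into a holomorphic function
  -- `u`; exchanging the roles of `g`, `h` and their transforms gives its inverse.
  set u : Kˣ → K := fun z => a z * g (σ z) + b z * h (σ z) with hu
  have hug : ∀ z, g (σ z) = u z * g z := fun z => by
    simp only [hu]
    linear_combination (-g (σ z)) * hab z + b z * hx z
  have huh : ∀ z, h (σ z) = u z * h z := fun z => by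
    simp only [hu]
    linear_combination (-h (σ z)) * hab z - a z * hx z
  obtain ⟨c, n, hc, hcn⟩ := IsHolomorphicGm.exists_monomial_of_mul_eq_one
    (f := u) (g := fun z => a (σ z) * g z + b (σ z) * h z)
    ((ha.mul (hσ g hg)).add (hb.mul (hσ h hh)))
    (((hσ a ha).mul hg).add ((hσ b hb).mul hh)) fun z => by
      have h1 := hab (σ z)
      rw [hug, huh] at h1
      rw [← h1]; ring
  exact ⟨c, n, hc, fun z => ⟨by rw [← hcn]; exact hug z, by rw [← hcn]; exact huh z⟩⟩

/-- An invariant analytic map on the Tate curve is given by symmetric theta functions. -/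
theorem IsAnalyticToP1.exists_symmTheta (h2 : (2 : K) ≠ 0) {t : Kˣ}
    {f : TateCurve (t ^ (-2 : ℤ)) → OnePoint K} (hf : IsAnalyticToP1 f)
    (hinv : ∀ P, f P⁻¹ = f P) :
    ∃ (e : ℤ) (g h a b : Kˣ → K), IsSymmTheta (t ^ (-2 : ℤ)) e g ∧
      IsSymmTheta (t ^ (-2 : ℤ)) e h ∧ IsHolomorphicGm a ∧ IsHolomorphicGm b ∧
      (∀ z, a z * g z + b z * h z = 1) ∧
      ∀ z : Kˣ, f (QuotientGroup.mk z) = projPoint (g z) (h z) := by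
  obtain ⟨g, h, hg, hh, ⟨a, b, ha, hb, hab⟩, hfz⟩ := hf
  have hneg : (-1 : K) ≠ 1 := fun h0 => h2 (by linear_combination -h0)
  -- the factor of the inversion
  obtain ⟨c, m, hc, hcm⟩ := exists_automorphy_factor hg hh ha hb hab (σ := fun z => z⁻¹)
    (fun f hf => hf.comp_inv) fun z => by
      rw [← hfz, ← hfz, ← hinv, ← QuotientGroup.mk_inv, inv_inv]
  -- At a fixed point the factor must be `1`, since `g` and `h` have no common zero. This is applied
  -- at `1`, giving `c = 1`, and at `-1`, giving that `m` is even.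
  have hfix : ∀ z : Kˣ, ∀ v : K, g z = v * g z → h z = v * h z → v = 1 := by
    intro z v h1 h3
    linear_combination -(v - 1) * hab z - a z * h1 - b z * h3
  have hc1 : c = 1 := by
    have := hcm 1
    simp only [inv_one, one_zpow, Units.val_one, mul_one] at this
    exact hfix 1 c this.1 this.2
  subst hc1
  simp only [one_mul] at hcm
  have hpar : ∀ k : ℤ, (((-1 : Kˣ) ^ k : Kˣ) : K) = 1 → Even k := by
    intro k hk
    rcases Int.even_or_odd k with he | ho
    · exact he
    · rw [ho.neg_one_zpow] at hk
      exact absurd (by simpa using hk) hneg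
  obtain ⟨j, rfl⟩ : Even m := by
    have := hcm (-1)
    rw [inv_neg, inv_one] at this
    exact hpar m (hfix _ _ this.1 this.2)
  -- From `g z⁻¹ = z ^ (2 j) * g z`, multiplication by `z ^ j` makes the pair invariant under
  -- inversion without changing the map to `ℙ¹`.
  have hg' := hg.zpow_mul j
  have hh' := hh.zpow_mul j
  have ha' := ha.zpow_mul (-j)
  have hb' := hb.zpow_mul (-j)
  set g' : Kˣ → K := fun z => ((z ^ j : Kˣ) : K) * g z with hg'd
  set h' : Kˣ → K := fun z => ((z ^ j : Kˣ) : K) * h z with hh'd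
  set a' : Kˣ → K := fun z => ((z ^ (-j) : Kˣ) : K) * a z with ha'd
  set b' : Kˣ → K := fun z => ((z ^ (-j) : Kˣ) : K) * b z with hb'd
  have hjj : ∀ z : Kˣ, ((z ^ (-j) : Kˣ) : K) * ((z ^ j : Kˣ) : K) = 1 := fun z => by
    rw [← Units.val_mul, ← zpow_add]; simp
  have hab' : ∀ z, a' z * g' z + b' z * h' z = 1 := fun z => by
    simp only [hg'd, hh'd, ha'd, hb'd]
    linear_combination (a z * g z + b z * h z) * hjj z + hab z
  have hfz' : ∀ z : Kˣ, f (QuotientGroup.mk z) = projPoint (g' z) (h' z) := fun z => by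
    rw [hfz, hg'd, hh'd, projPoint_mul (Units.ne_zero _)]
  have hsymm : ∀ z, g' z⁻¹ = g' z ∧ h' z⁻¹ = h' z := fun z => by
    simp only [hg'd, hh'd, (hcm z).1, (hcm z).2]
    have : (((z⁻¹) ^ j : Kˣ) : K) * ((z ^ (j + j) : Kˣ) : K) = ((z ^ j : Kˣ) : K) := by
      rw [← Units.val_mul, inv_zpow', ← zpow_add]; simp
    exact ⟨by rw [← mul_assoc, this], by rw [← mul_assoc, this]⟩
  have hfix' : ∀ z : Kˣ, ∀ v : K, g' z = v * g' z → h' z = v * h' z → v = 1 := by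
    intro z v h1 h3
    linear_combination -(v - 1) * hab' z - a' z * h1 - b' z * h3
  -- the factor of the translation by `q`
  obtain ⟨c, n, hc, hcn⟩ := exists_automorphy_factor hg' hh' ha' hb' hab'
    (σ := fun z => t ^ (-2 : ℤ) * z) (fun f hf => hf.comp_mul _) fun z => by
      rw [← hfz', ← hfz']
      congr 1
      rw [QuotientGroup.eq]
      exact ⟨-1, by simp⟩
  -- At `±t` translation by `q` agrees with inversion, so the factor `c zⁿ` is `1` there. Hence `n`
  -- is even and `c = t ^ (-n)`, a power of `q`.
  have ht1 : t ^ (-2 : ℤ) * t = t⁻¹ := by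
    rw [← zpow_add_one]; norm_num
  have ht2 : t ^ (-2 : ℤ) * (-t) = (-t)⁻¹ := by rw [mul_neg, ht1, inv_neg]
  have hct : c * ((t ^ n : Kˣ) : K) = 1 := by
    have := hcn t
    simp only [ht1, (hsymm t).1, (hsymm t).2] at this
    exact hfix' t _ this.1 this.2
  have hct' : c * (((-t) ^ n : Kˣ) : K) = 1 := by
    have := hcn (-t)
    simp only [ht2, (hsymm (-t)).1, (hsymm (-t)).2] at this
    exact hfix' (-t) _ this.1 this.2
  obtain ⟨e, rfl⟩ : Even n := by
    refine hpar n ?_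
    rw [neg_eq_neg_one_mul, mul_zpow, Units.val_mul] at hct'
    linear_combination hct' - (((-1 : Kˣ) ^ n : Kˣ) : K) * hct
  have hfac : ∀ z : Kˣ, c * ((z ^ (e + e) : Kˣ) : K) =
      (((t ^ (-2 : ℤ)) ^ (-(-e)) * z ^ (-2 * -e) : Kˣ) : K) := fun z => by
    have h1 : c = ((t ^ (-(e + e)) : Kˣ) : K) := by
      have : ((t ^ (e + e) : Kˣ) : K) * ((t ^ (-(e + e)) : Kˣ) : K) = 1 := by
        rw [← Units.val_mul, ← zpow_add]; simp
      linear_combination (-c) * this + ((t ^ (-(e + e)) : Kˣ) : K) * hct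
    rw [h1, ← Units.val_mul, ← zpow_mul]
    congr 3 <;> ring
  refine ⟨-e, g', h', a', b', ⟨hg', fun z => (hsymm z).1, fun z => ?_⟩,
    ⟨hh', fun z => (hsymm z).2, fun z => ?_⟩, ha', hb', hab', hfz'⟩
  · rw [(hcn z).1, hfac]
  · rw [(hcn z).2, hfac]

end Automorphy

/-! ### Convergence of series with quadratically growing exponents of `q`. -/

section QuadraticDecay

theorem HasSum.int_even_add_odd {M : Type*} [AddCommMonoid M] [TopologicalSpace M] [ContinuousAdd M]
    {f : ℤ → M} {a b : M} (he : HasSum (fun k => f (2 * k)) a)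
    (ho : HasSum (fun k => f (2 * k + 1)) b) : HasSum f (a + b) := by
  have h2 : Function.Injective fun k : ℤ => 2 * k := fun x y h => by simpa using h
  have h3 : Function.Injective fun k : ℤ => 2 * k + 1 := fun x y h => by simpa using h
  replace he := h2.hasSum_range_iff.2 he
  replace ho := h3.hasSum_range_iff.2 ho
  refine he.add_isCompl ?_ ho
  have e1 : Set.range (fun k : ℤ => 2 * k) = {n | Even n} := by
    ext n; simp [even_iff_exists_two_mul]
  have e2 : Set.range (fun k : ℤ => 2 * k + 1) = {n | Odd n} := by
    ext n; simp [Odd]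
  rw [e1, e2]
  exact Int.isCompl_even_odd

variable {K : Type*} [NontriviallyNormedField K]

theorem exists_norm_zpow_le {q : Kˣ} (hq : ‖(q : K)‖ < 1) (z : Kˣ) :
    ∃ M : ℕ, ∀ j : ℤ, ‖((z ^ j : Kˣ) : K)‖ ≤ ‖(q : K)‖ ^ (-(M * |j|)) := by
  have hq0 : 0 < ‖(q : K)‖ := norm_pos_iff.2 q.ne_zero
  have key : ∀ z : Kˣ, ∃ M : ℕ, ∀ N, M ≤ N → ‖(z : K)‖ ≤ ‖(q : K)‖ ^ (-(N : ℤ)) := fun z => by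
    obtain ⟨M, hM⟩ := pow_unbounded_of_one_lt ‖(z : K)‖ (one_lt_inv₀ hq0 |>.2 hq)
    refine ⟨M, fun N hN => hM.le.trans ?_⟩
    rw [zpow_neg, zpow_natCast, ← inv_pow]
    exact pow_le_pow_right₀ (one_lt_inv₀ hq0 |>.2 hq).le hN
  obtain ⟨M₁, h₁⟩ := key z
  obtain ⟨M₂, h₂⟩ := key z⁻¹
  refine ⟨max M₁ M₂, fun j => ?_⟩
  rcases le_total 0 j with hj | hj
  · obtain ⟨n, rfl⟩ := Int.eq_ofNat_of_zero_le hj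
    rw [abs_of_nonneg hj, zpow_natCast, Units.val_pow_eq_pow_val, norm_pow, ← neg_mul, zpow_mul,
      zpow_natCast]
    exact pow_le_pow_left₀ (norm_nonneg _) (h₁ _ (le_max_left _ _)) n
  · obtain ⟨n, hn⟩ := Int.eq_ofNat_of_zero_le (neg_nonneg.2 hj)
    obtain rfl : j = -n := by linarith
    rw [abs_of_nonpos hj, neg_neg, ← inv_zpow', zpow_natCast, Units.val_pow_eq_pow_val, norm_pow,
      ← neg_mul, zpow_mul, zpow_natCast]
    exact pow_le_pow_left₀ (norm_nonneg _) (h₂ _ (le_max_right _ _)) n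

theorem summable_pow_natAbs {q : K} (hq : ‖q‖ < 1) : Summable fun n : ℤ => q ^ n.natAbs :=
  Summable.of_nat_of_neg (by simpa using summable_geometric_of_norm_lt_one hq)
    (by simpa using summable_geometric_of_norm_lt_one hq)

variable [IsUltrametricDist K] [CompleteSpace K]

/-- A fixed `z` costs only a linear amount in the exponent, `|z ^ j| ≤ |q| ^ (-M |j|)`, which the
quadratic growth of `E` absorbs. What remains is dominated by a product of two geometric series. -/
theorem summable_of_quadratic_decay₂ {q : Kˣ} (hq : ‖(q : K)‖ < 1) (z : Kˣ) {f : ℤ × ℤ → K}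
    {E : ℤ × ℤ → ℤ} {D : ℕ} (hE : ∀ p, p.1 ^ 2 + p.2 ^ 2 ≤ D * (E p + |p.1| + |p.2|))
    (hf : ∀ p, ‖f p‖ ≤ ‖(q : K)‖ ^ E p * ‖((z ^ p.2 : Kˣ) : K)‖) : Summable f := by
  have hq0 : 0 < ‖(q : K)‖ := norm_pos_iff.2 q.ne_zero
  obtain ⟨M, hM⟩ := exists_norm_zpow_le hq z
  have hD : 0 < (D : ℤ) := by
    rcases Nat.eq_zero_or_pos D with rfl | h
    · have := hE (1, 1)
      norm_num at this
    · exact_mod_cast h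
  -- `B` collects the linear losses: `D * M` from `z`, `D` from the hypothesis on `E`, and `D` for
  -- the geometric decay to be left over. The inequality `B * a ≤ a ^ 2 + B ^ 2`, used for both
  -- indices, accounts for the constant `2 * B ^ 2`.
  set B : ℤ := D * (M + 2) with hB
  have hs : Summable fun p : ℤ × ℤ =>
      ((q ^ (-(2 * B ^ 2)) : Kˣ) : K) * ((q : K) ^ p.1.natAbs * (q : K) ^ p.2.natAbs) :=
    ((summable_pow_natAbs hq).mul_of_nonarchimedean (summable_pow_natAbs hq)).mul_left _
  refine hs.of_norm_le_of_ultrametric fun p => ?_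
  have e : ‖((q ^ (-(2 * B ^ 2)) : Kˣ) : K) * ((q : K) ^ p.1.natAbs * (q : K) ^ p.2.natAbs)‖ =
      ‖(q : K)‖ ^ (-(2 * B ^ 2) + |p.1| + |p.2|) := by
    rw [zpow_add₀ hq0.ne', zpow_add₀ hq0.ne', Int.abs_eq_natAbs, Int.abs_eq_natAbs]
    simp only [Units.val_zpow_eq_zpow_val, norm_mul, norm_pow, norm_zpow, zpow_natCast, mul_assoc]
  rw [e]
  calc ‖f p‖ ≤ ‖(q : K)‖ ^ E p * ‖(q : K)‖ ^ (-(M * |p.2|)) := by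
        refine (hf p).trans ?_
        gcongr
        exact hM _
    _ = ‖(q : K)‖ ^ (E p - M * |p.2|) := by rw [← zpow_add₀ hq0.ne', ← sub_eq_add_neg]
    _ ≤ _ := by
        refine zpow_le_zpow_right_of_le_one₀ hq0 hq.le ?_
        have h1 := hE p
        have ha := abs_nonneg p.1
        have hb := abs_nonneg p.2
        rw [← sq_abs p.1, ← sq_abs p.2] at h1
        generalize |p.1| = a at *
        generalize |p.2| = b at *
        have hM0 : (0 : ℤ) ≤ M := Int.natCast_nonneg M
        have hB0 : 0 ≤ B := by positivity
        have hD1 : (1 : ℤ) ≤ D := hD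
        refine le_of_mul_le_mul_left ?_ hD
        have h2 : B * a ≤ a ^ 2 + B ^ 2 := by nlinarith [sq_nonneg (a - B), sq_nonneg a]
        have h3 : B * b ≤ b ^ 2 + B ^ 2 := by nlinarith [sq_nonneg (b - B), sq_nonneg b]
        have h4 : 2 * B ^ 2 ≤ D * (2 * B ^ 2) := by nlinarith [sq_nonneg B]
        have h5 : 0 ≤ (D : ℤ) * M * a := by positivity
        rw [hB] at h2 h3
        rw [hB] at h4 ⊢
        nlinarith

theorem summable_of_quadratic_decay {q : Kˣ} (hq : ‖(q : K)‖ < 1) (z : Kˣ) {f : ℤ → K}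
    {E : ℤ → ℤ} {D : ℕ} (hE : ∀ n, n ^ 2 ≤ D * (E n + |n|))
    (hf : ∀ n, ‖f n‖ ≤ ‖(q : K)‖ ^ E n * ‖((z ^ n : Kˣ) : K)‖) : Summable f := by
  have hq0 : 0 < ‖(q : K)‖ := norm_pos_iff.2 q.ne_zero
  have hD : 1 ≤ (D : ℤ) := by
    rcases Nat.eq_zero_or_pos D with rfl | h
    · have := hE 1
      norm_num at this
    · exact_mod_cast h
  -- Multiplying by `q ^ (m ^ 2)` makes this a double series, of which the slice `m = 0` is the
  -- given one.
  have := (summable_of_quadratic_decay₂ hq z (f := fun p => f p.2 * ((q ^ (p.1 ^ 2) : Kˣ) : K))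
    (E := fun p => E p.2 + p.1 ^ 2) (D := D) (fun p => ?_) fun p => ?_).prod_factor 0
  · simpa using this
  · have h1 := hE p.2
    have h2 := abs_nonneg p.1
    nlinarith [sq_nonneg p.1]
  · rw [norm_mul, zpow_add₀ hq0.ne', Units.val_zpow_eq_zpow_val, norm_zpow, mul_right_comm]
    gcongr
    exact hf p.2

end QuadraticDecay

/-! ### The theta series and its transformation laws. -/

section ThetaSeries

variable {K : Type*} [NontriviallyNormedField K]

theorem IsLaurentSum.comp_sq {a : ℤ → K} {f : Kˣ → K} (hf : IsLaurentSum a f) :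
    IsLaurentSum (Function.extend (fun n : ℤ => 2 * n) a 0) (fun z => f (z ^ 2)) := fun z => by
  have hinj : Function.Injective fun n : ℤ => 2 * n := fun x y h => by simpa using h
  refine (hinj.hasSum_iff fun n hn => ?_).1 ((hf (z ^ 2)).congr_terms fun n => ?_)
  · rw [Function.extend_apply' _ _ _ hn]; simp
  · simp only [Function.comp, hinj.extend_apply]
    rw [_root_.zpow_mul]; rfl

theorem IsHolomorphicGm.comp_sq {f : Kˣ → K} (hf : IsHolomorphicGm f) :
    IsHolomorphicGm (fun z => f (z ^ 2)) :=
  let ⟨_, ha⟩ := hf; ⟨_, IsLaurentSum.comp_sq ha⟩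

/-- The theta series `∑ s ^ (n ^ 2) z ^ n`. -/
noncomputable def thetaSeries (s z : Kˣ) : K := ∑' n : ℤ, ((s ^ (n ^ 2) * z ^ n : Kˣ) : K)

variable [IsUltrametricDist K] [CompleteSpace K]

theorem hasSum_thetaSeries {s : Kˣ} (hs : ‖(s : K)‖ < 1) (z : Kˣ) :
    HasSum (fun n : ℤ => ((s ^ (n ^ 2) * z ^ n : Kˣ) : K)) (thetaSeries s z) := by
  refine (summable_of_quadratic_decay hs z (E := fun n => n ^ 2) (D := 1) (fun n => ?_)
    fun n => ?_).hasSum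
  · have := abs_nonneg n
    push_cast
    linarith
  · rw [Units.val_mul, norm_mul, Units.val_zpow_eq_zpow_val s, norm_zpow]

theorem isLaurentSum_thetaSeries {s : Kˣ} (hs : ‖(s : K)‖ < 1) :
    IsLaurentSum (fun n => ((s ^ (n ^ 2) : Kˣ) : K)) (thetaSeries s) :=
  fun z => (hasSum_thetaSeries hs z).congr_terms fun n => by rw [Units.val_mul]

theorem thetaSeries_inv {s : Kˣ} (hs : ‖(s : K)‖ < 1) (z : Kˣ) :
    thetaSeries s z⁻¹ = thetaSeries s z :=
  ((Equiv.neg ℤ).hasSum_iff.2 (hasSum_thetaSeries hs z⁻¹)).unique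
    ((hasSum_thetaSeries hs z).congr_terms fun n => by simp)

theorem thetaSeries_zpow_mul {s : Kˣ} (hs : ‖(s : K)‖ < 1) (k : ℤ) (z : Kˣ) :
    thetaSeries s (s ^ (2 * k) * z) =
      ((s ^ (-k ^ 2) * z ^ (-k) : Kˣ) : K) * thetaSeries s z := by
  refine (hasSum_thetaSeries hs _).unique
    ((((Equiv.addRight k).hasSum_iff.2 (hasSum_thetaSeries hs z)).mul_left _).congr_terms
      fun n => ?_)
  simp only [Function.comp, Equiv.coe_addRight]
  rw [← Units.val_mul]
  congr 1
  rw [mul_zpow, ← zpow_mul, mul_mul_mul_comm, ← zpow_add, ← zpow_add, ← mul_assoc, ← zpow_add]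
  congr 2 <;> ring

theorem norm_thetaSeries_one {s : Kˣ} (hs : ‖(s : K)‖ < 1) : ‖thetaSeries s 1‖ = 1 := by
  have := (hasSum_thetaSeries hs 1).norm_eq_of_dominant (i := 0) (by simp) fun j hj => ?_
  · simpa using this
  · have hs0 : 0 < ‖(s : K)‖ := norm_pos_iff.2 s.ne_zero
    have hj' : (0 : ℤ) < j ^ 2 := by positivity
    obtain ⟨m, hm⟩ := Int.eq_ofNat_of_zero_le hj'.le
    simp only [hm, one_zpow, mul_one]
    rw [zpow_natCast]
    simp only [Units.val_pow_eq_pow_val, norm_pow]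
    have : m ≠ 0 := by rintro rfl; simp at hm; exact hj hm
    simpa using pow_lt_one₀ hs0.le hs this

/-- The exponent `n ^ 2 + n` is unchanged by `n ↦ -1 - n`, so the series is twice its half over `ℕ`,
whose leading term is `1`. Splitting off the exact factor `2` gives nonvanishing even when `|2| <
1`. -/
theorem thetaSeries_self_eq {s : Kˣ} (hs : ‖(s : K)‖ < 1) :
    ∃ u : K, ‖u‖ = 1 ∧ thetaSeries s s = 2 * u := by
  have hsum : Summable fun n : ℕ => (s : K) ^ (n ^ 2 + n) := by
    have := ((hasSum_thetaSeries hs s).summable.comp_injective Nat.cast_injective)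
    refine this.hasSum.congr_terms (fun n => ?_) |>.summable
    simp only [Function.comp]
    rw [← zpow_add, ← Units.val_pow_eq_pow_val, ← zpow_natCast]
    push_cast
    rfl
  refine ⟨∑' n : ℕ, (s : K) ^ (n ^ 2 + n), ?_, ?_⟩
  · have := hsum.hasSum.norm_eq_of_dominant (i := 0) (by simp) fun j hj => ?_
    · simpa using this
    · rw [norm_pow]
      simpa using pow_lt_one₀ (norm_nonneg _) hs (by positivity)
  · have h := (hasSum_thetaSeries hs s).nat_add_neg_add_one
    refine h.unique ((hsum.hasSum.mul_left 2).congr_terms fun n => ?_)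
    rw [← zpow_add, ← zpow_add, two_mul, ← Units.val_pow_eq_pow_val, ← zpow_natCast]
    congr 3
    push_cast
    ring

end ThetaSeries

/-! ### Laurent coefficients of symmetric theta functions. -/

section SymmTheta

variable {K : Type*} [NontriviallyNormedField K]

namespace IsSymmTheta

theorem const (q : Kˣ) (c : K) : IsSymmTheta q 0 (fun _ => c) :=
  ⟨IsHolomorphicGm.const c, fun _ => rfl, fun _ => by simp⟩

theorem const_mul {q : Kˣ} {e : ℤ} {f : Kˣ → K} (c : K) (hf : IsSymmTheta q e f) :
    IsSymmTheta q e (fun z => c * f z) :=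
  ⟨hf.holomorphic.const_mul c, fun z => by rw [hf.inv], fun z => by rw [hf.shift]; ring⟩

theorem add {q : Kˣ} {e : ℤ} {f g : Kˣ → K} (hf : IsSymmTheta q e f) (hg : IsSymmTheta q e g) :
    IsSymmTheta q e (fun z => f z + g z) :=
  ⟨hf.holomorphic.add hg.holomorphic, fun z => by rw [hf.inv, hg.inv],
    fun z => by rw [hf.shift, hg.shift]; ring⟩

theorem sum {ι : Type*} {q : Kˣ} {e : ℤ} (s : Finset ι) {f : ι → Kˣ → K}
    (hf : ∀ i ∈ s, IsSymmTheta q e (f i)) : IsSymmTheta q e (fun z => ∑ i ∈ s, f i z) := by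
  classical
  induction s using Finset.induction_on with
  | empty => exact ⟨by simpa using IsHolomorphicGm.const (K := K) 0, by simp, by simp⟩
  | insert i s hi ih =>
    simp only [Finset.sum_insert hi]
    exact (hf i (by simp)).add (ih fun j hj => hf j (by simp [hj]))

variable [IsUltrametricDist K] [CompleteSpace K]

theorem mul {q : Kˣ} {d e : ℤ} {f g : Kˣ → K} (hf : IsSymmTheta q d f) (hg : IsSymmTheta q e g) :
    IsSymmTheta q (d + e) (fun z => f z * g z) :=
  ⟨hf.holomorphic.mul hg.holomorphic, fun z => by rw [hf.inv, hg.inv], fun z => by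
    rw [hf.shift, hg.shift, mul_mul_mul_comm, ← Units.val_mul, mul_mul_mul_comm, ← zpow_add,
      ← zpow_add]
    congr 4 <;> ring⟩

theorem pow {q : Kˣ} {e : ℤ} {f : Kˣ → K} (hf : IsSymmTheta q e f) (n : ℕ) :
    IsSymmTheta q (n * e) (fun z => f z ^ n) := by
  induction n with
  | zero => simpa using const q 1
  | succ n ih =>
    simp only [pow_succ]
    have := ih.mul hf
    rwa [show (n : ℤ) * e + e = ((n + 1 : ℕ) : ℤ) * e by push_cast; ring] at this

theorem coeff_neg {q : Kˣ} {e : ℤ} {f : Kˣ → K} (hf : IsSymmTheta q e f) {a : ℤ → K}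
    (ha : IsLaurentSum a f) (k : ℤ) : a (-k) = a k := by
  have := ha.comp_inv
  simp only [hf.inv] at this
  exact congrFun (this.coeff_unique ha) k

theorem coeff_shift {q : Kˣ} {e : ℤ} {f : Kˣ → K} (hf : IsSymmTheta q e f) {a : ℤ → K}
    (ha : IsLaurentSum a f) (k : ℤ) : a (k + 2 * e) = ((q ^ (e + k) : Kˣ) : K) * a k := by
  have h1 := ha.comp_mul q
  have h2 := (ha.zpow_mul (-2 * e)).const_mul ((q ^ (-e) : Kˣ) : K)
  have h3 := h1.coeff_unique (b := fun n => ((q ^ (-e) : Kˣ) : K) * a (n - -2 * e)) fun z => by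
    have := h2 z
    simp only at this ⊢
    rwa [← mul_assoc, ← Units.val_mul, ← hf.shift] at this
  have h4 := congrFun h3 k
  rw [show k - -2 * e = k + 2 * e by ring] at h4
  have h5 : ((q ^ e : Kˣ) : K) * ((q ^ (-e) : Kˣ) : K) = 1 := by
    rw [← Units.val_mul, ← zpow_add]; simp
  rw [zpow_add, Units.val_mul]
  linear_combination (-a (k + 2 * e)) * h5 - ((q ^ e : Kˣ) : K) * h4

/-- In negative degree the recursion makes the coefficients grow weakly in absolute value along `k,
k + 2e, k + 4e, …` for `k ≤ 0`, whereas convergence at `z = 1` makes them tend to zero. -/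
theorem eq_zero_of_neg {q : Kˣ} (hq : ‖(q : K)‖ < 1) {e : ℤ} (he : e < 0) {f : Kˣ → K}
    (hf : IsSymmTheta q e f) : f = 0 := by
  obtain ⟨a, ha : IsLaurentSum a f⟩ := hf.holomorphic
  have hq0 : 0 < ‖(q : K)‖ := norm_pos_iff.2 q.ne_zero
  have hstep : ∀ k : ℤ, k ≤ 0 → ‖a k‖ ≤ ‖a (k + 2 * e)‖ := fun k hk => by
    rw [hf.coeff_shift ha, norm_mul, Units.val_zpow_eq_zpow_val, norm_zpow]
    refine le_mul_of_one_le_left (norm_nonneg _) ?_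
    exact one_le_zpow_of_nonpos₀ hq0 hq.le (by linarith)
  have hiter : ∀ k : ℤ, k ≤ 0 → ∀ n : ℕ, ‖a k‖ ≤ ‖a (k + n * (2 * e))‖ := fun k hk n => by
    induction n with
    | zero => simp
    | succ n ih =>
      refine ih.trans ((hstep _ ?_).trans_eq ?_)
      · nlinarith [Int.natCast_nonneg n]
      · congr 2; push_cast; ring
  have hzero : ∀ k : ℤ, k ≤ 0 → a k = 0 := fun k hk => by
    have h1 : Tendsto (fun n => ‖a n‖) cofinite (𝓝 0) := by simpa using ha.tendsto_norm one_pos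
    have hinj : Function.Injective fun n : ℕ => k + n * (2 * e) := fun x y h => by
      have : (2 * e) ≠ 0 := by omega
      simpa [this, he.ne] using h
    have h2 := (h1.comp hinj.tendsto_cofinite)
    rw [Nat.cofinite_eq_atTop] at h2
    exact norm_le_zero_iff.1 (ge_of_tendsto' h2 (hiter k hk))
  have : a = 0 := funext fun k => by
    rcases le_total k 0 with h | h
    · exact hzero k h
    · rw [← hf.coeff_neg ha]; exact hzero _ (by linarith)
  subst this
  exact ha.eq_zero_of_coeff

/-- A symmetric theta function of degree `2e` is determined by `e + 1` of its coefficients. -/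
theorem coeff_eq_zero {q : Kˣ} (hq : ‖(q : K)‖ < 1) {e : ℕ} {f : Kˣ → K}
    (hf : IsSymmTheta q e f) {a : ℤ → K} (ha : IsLaurentSum a f)
    (h0 : ∀ k : ℕ, k ≤ e → a k = 0) : a = 0 := by
  have hnat : ∀ k : ℕ, a k = 0 := by
    intro k
    induction k using Nat.strong_induction_on with
    | _ k ih =>
      rcases le_or_gt k e with hk | hk
      · exact h0 k hk
      -- In degree zero the recursion reads `a k = q ^ k * a k`. Otherwise it relates `a k` to `a (k
      -- - 2 e)`, and `|k - 2 e| < k` because `k > e > 0`; the symmetry `a (-k) = a k` covers a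
      -- negative index.
      rcases Nat.eq_zero_or_pos e with rfl | he
      · have h := hf.coeff_shift ha k
        simp only [Nat.cast_zero, mul_zero, add_zero, zero_add] at h
        have hne : ((q ^ (k : ℤ) : Kˣ) : K) ≠ 1 := fun h1 => by
          have := congrArg norm h1
          rw [zpow_natCast, Units.val_pow_eq_pow_val, norm_pow, norm_one] at this
          exact (pow_lt_one₀ (norm_nonneg _) hq hk.ne').ne this
        have h3 : (((q ^ (k : ℤ) : Kˣ) : K) - 1) * a k = 0 := by linear_combination -h
        exact (mul_eq_zero.1 h3).resolve_left (sub_ne_zero.2 hne)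
      · have h := hf.coeff_shift ha ((k : ℤ) - 2 * e)
        rw [sub_add_cancel] at h
        rw [h]
        rcases le_total (2 * e) k with h2 | h2
        · obtain ⟨m, rfl⟩ := Nat.exists_eq_add_of_le h2
          have := ih m (by omega)
          rw [show ((2 * e + m : ℕ) : ℤ) - 2 * e = m by push_cast; ring, this, mul_zero]
        · obtain ⟨m, hm⟩ := Nat.exists_eq_add_of_le h2
          have := ih m (by omega)
          rw [show (k : ℤ) - 2 * e = -m by linarith [show (2 * e : ℤ) = k + m by exact_mod_cast hm],
            hf.coeff_neg ha, this, mul_zero]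
  funext k
  rcases le_total 0 k with hk | hk
  · obtain ⟨n, rfl⟩ := Int.eq_ofNat_of_zero_le hk
    exact hnat n
  · obtain ⟨n, hn⟩ := Int.eq_ofNat_of_zero_le (neg_nonneg.2 hk)
    rw [← hf.coeff_neg ha, hn]
    exact hnat n

end IsSymmTheta

end SymmTheta

/-! ### Binary forms, with values also in extension fields. -/

section BinaryForms

variable {K : Type*} [Field K]

/-- The value at `(x, y)` of the binary form of degree `n` with dehomogenization `P`. -/
def formEval {F : Type*} [CommRing F] [Algebra K F] (n : ℕ) (P : Polynomial K) (x y : F) : F :=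
  ∑ i ∈ Finset.range (n + 1), algebraMap K F (P.coeff i) * x ^ i * y ^ (n - i)

variable {F : Type*} [Field F] [Algebra K F]

theorem formEval_zero_right (n : ℕ) (P : Polynomial K) (x : F) :
    formEval n P x 0 = algebraMap K F (P.coeff n) * x ^ n := by
  unfold formEval
  rw [Finset.sum_eq_single n]
  · simp
  · intro i hi hne
    have : n - i ≠ 0 := by have := Finset.mem_range.1 hi; omega
    simp [this]
  · simp

theorem formEval_of_ne_zero {n : ℕ} {P : Polynomial K} (hP : P.natDegree ≤ n) (x : F) {y : F}
    (hy : y ≠ 0) : formEval n P x y = y ^ n * Polynomial.aeval (x / y) P := by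
  unfold formEval
  rw [Polynomial.aeval_def, Polynomial.eval₂_eq_sum_range' _ (Nat.lt_succ_of_le hP),
    Finset.mul_sum]
  refine Finset.sum_congr rfl fun i hi => ?_
  have hi' : i ≤ n := Nat.lt_succ_iff.1 (Finset.mem_range.1 hi)
  rw [div_pow, ← Nat.sub_add_cancel hi', pow_add, Nat.add_sub_cancel]
  field_simp

theorem formEval_mul {m n : ℕ} {P Q : Polynomial K} (hP : P.natDegree ≤ m) (hQ : Q.natDegree ≤ n)
    (x y : F) : formEval (m + n) (P * Q) x y = formEval m P x y * formEval n Q x y := by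
  by_cases hy : y = 0
  · subst hy
    simp only [formEval_zero_right, Polynomial.coeff_mul_add_eq_of_natDegree_le hP hQ, map_mul]
    ring
  · rw [formEval_of_ne_zero hP x hy, formEval_of_ne_zero hQ x hy, formEval_of_ne_zero
      (Polynomial.natDegree_mul_le.trans (add_le_add hP hQ)) x hy, map_mul]
    ring

/-- Coprime binary forms have no common zero. -/
theorem formEval_ne_zero_of_isCoprime {P Q : Polynomial K} (h : IsCoprime P Q) {x y : F}
    (hxy : x ≠ 0 ∨ y ≠ 0) :
    formEval (max P.natDegree Q.natDegree) P x y ≠ 0 ∨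
      formEval (max P.natDegree Q.natDegree) Q x y ≠ 0 := by
  by_contra! h0
  by_cases hy : y = 0
  · subst hy
    have hx : x ≠ 0 := by simpa using hxy
    simp only [formEval_zero_right, mul_eq_zero, pow_eq_zero_iff', hx, ne_eq, false_and, or_false,
      map_eq_zero] at h0
    have hP : P = 0 ∨ P.natDegree < Q.natDegree := by
      rcases le_or_gt Q.natDegree P.natDegree with hle | hlt
      · rw [max_eq_left hle] at h0
        exact Or.inl (Polynomial.leadingCoeff_eq_zero.1 h0.1)
      · exact Or.inr hlt
    have hQ : Q = 0 ∨ Q.natDegree < P.natDegree := by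
      rcases le_or_gt P.natDegree Q.natDegree with hle | hlt
      · rw [max_eq_right hle] at h0
        exact Or.inl (Polynomial.leadingCoeff_eq_zero.1 h0.2)
      · exact Or.inr hlt
    rcases hP with rfl | hP <;> rcases hQ with rfl | hQ
    · exact not_isCoprime_zero_zero h
    · simp at hQ
    · simp at hP
    · omega
  · rw [formEval_of_ne_zero (le_max_left _ _) x hy, formEval_of_ne_zero (le_max_right _ _) x hy]
      at h0
    have hyn : ∀ n : ℕ, y ^ n ≠ 0 := fun n => pow_ne_zero n hy
    simp only [mul_eq_zero, hyn, false_or] at h0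
    obtain ⟨u, v, huv⟩ := h
    have := congrArg (Polynomial.aeval (x / y)) huv
    simp [h0.1, h0.2] at this

theorem ratMap_projPoint (P Q : Polynomial K) {x y : K} (hxy : x ≠ 0 ∨ y ≠ 0) :
    ratMap P Q (projPoint x y) = projPoint (formEval (max P.natDegree Q.natDegree) P x y)
      (formEval (max P.natDegree Q.natDegree) Q x y) := by
  by_cases hy : y = 0
  · subst hy
    have hx : x ≠ 0 := by simpa using hxy
    simp only [formEval_zero_right, Algebra.algebraMap_self, RingHom.id_apply]
    rw [mul_comm _ (x ^ _), mul_comm _ (x ^ _), projPoint_mul (pow_ne_zero _ hx)]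
    simp only [projPoint, if_true]
    rfl
  · rw [formEval_of_ne_zero (le_max_left _ _) x hy, formEval_of_ne_zero (le_max_right _ _) x hy,
      projPoint_mul (pow_ne_zero _ hy)]
    simp only [projPoint, hy, if_false]
    rfl

end BinaryForms

/-! ### Rational functions of degree one and invariance of the cross ratio. -/

section Moebius

variable {K : Type*} [Field K]

theorem map_formEval {F G : Type*} [CommRing F] [Algebra K F] [CommRing G] [Algebra K G]
    (φ : F →ₐ[K] G) (n : ℕ) (P : Polynomial K) (x y : F) :
    φ (formEval n P x y) = formEval n P (φ x) (φ y) := by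
  simp [formEval]

theorem natDegree_formEval_le {A B : Polynomial K} {d : ℕ} (hA : A.natDegree ≤ d)
    (hB : B.natDegree ≤ d) (e : ℕ) (C : Polynomial K) : (formEval e C A B).natDegree ≤ e * d := by
  refine Polynomial.natDegree_sum_le_of_forall_le _ _ fun i hi => ?_
  have hi' : i ≤ e := Nat.lt_succ_iff.1 (Finset.mem_range.1 hi)
  have h1 := Polynomial.natDegree_pow_le_of_le i hA
  have h2 := Polynomial.natDegree_pow_le_of_le (e - i) hB
  have h3 : (algebraMap K (Polynomial K) (C.coeff i)).natDegree ≤ 0 :=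
    (Polynomial.natDegree_C _).le
  have := Polynomial.natDegree_mul_le_of_le (Polynomial.natDegree_mul_le_of_le h3 h1) h2
  rwa [zero_add, ← add_mul, Nat.add_sub_cancel' hi'] at this

theorem coeff_formEval {A B : Polynomial K} {d : ℕ} (hA : A.natDegree ≤ d)
    (hB : B.natDegree ≤ d) (e : ℕ) (C : Polynomial K) :
    (formEval e C A B).coeff (e * d) = formEval e C (A.coeff d) (B.coeff d) := by
  unfold formEval
  rw [Polynomial.finsetSum_coeff]
  refine Finset.sum_congr rfl fun i hi => ?_
  have hi' : i ≤ e := Nat.lt_succ_iff.1 (Finset.mem_range.1 hi)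
  rw [mul_assoc, ← Polynomial.C_eq_algebraMap, Polynomial.coeff_C_mul, mul_assoc]
  congr 1
  conv_lhs => rw [← Nat.add_sub_cancel' hi', add_mul, Nat.add_sub_cancel' hi']
  rw [Polynomial.coeff_mul_add_eq_of_natDegree_le (Polynomial.natDegree_pow_le_of_le i hA)
    (Polynomial.natDegree_pow_le_of_le (e - i) hB), Polynomial.coeff_pow_of_natDegree_le hA,
    Polynomial.coeff_pow_of_natDegree_le hB]

/-- A rational function with a left inverse has degree one. -/
theorem max_natDegree_eq_one_of_leftInverse {A B C D : Polynomial K} (hAB : IsCoprime A B)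
    (hCD : IsCoprime C D) {S : Set K} (hS : S.Infinite)
    (h : ∀ x ∈ S, ratMap C D (ratMap A B (x : OnePoint K)) = (x : OnePoint K)) :
    max A.natDegree B.natDegree = 1 := by
  set d := max A.natDegree B.natDegree with hd
  set e := max C.natDegree D.natDegree with he
  set U : Polynomial K := formEval e C A B with hU
  set V : Polynomial K := formEval e D A B with hV
  have heval : ∀ (P : Polynomial K) (x : K), (formEval e P A B).eval x =
      formEval e P (A.eval x) (B.eval x) := fun P x => by
    have := map_formEval (Polynomial.aeval (R := K) x) e P A B
    simpa [Polynomial.coe_aeval_eq_eval] using this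
  have hUV : U = Polynomial.X * V := by
    refine Polynomial.eq_of_infinite_eval_eq _ _ (hS.mono fun x hx => ?_)
    have h0 : A.eval x ≠ 0 ∨ B.eval x ≠ 0 := by
      by_contra! h0
      obtain ⟨u, v, huv⟩ := hAB
      have := congrArg (Polynomial.eval x) huv
      simp [h0.1, h0.2] at this
    have h1 := h x hx
    rw [show ratMap A B (x : OnePoint K) = projPoint (A.eval x) (B.eval x) from rfl,
      ratMap_projPoint _ _ h0, show (x : OnePoint K) = projPoint x 1 by simp [projPoint],
      projPoint_eq_iff (formEval_ne_zero_of_isCoprime hCD h0) (Or.inr one_ne_zero), mul_one,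
      ← heval, ← heval] at h1
    simpa using h1
  -- At a root of `V` in `K[X]/(p)`, the relation `U = X * V` makes `U` vanish too; but coprime
  -- forms have no common zero at a point `[A : B]`, over any extension.
  have hunit : IsUnit V := by
    by_contra hnu
    obtain ⟨p, hp, hpV⟩ : ∃ p : Polynomial K, Irreducible p ∧ p ∣ V := by
      by_cases hV0 : V = 0
      · exact ⟨Polynomial.X, Polynomial.irreducible_X, hV0 ▸ dvd_zero _⟩
      · exact WfDvdMonoid.exists_irreducible_factor hnu hV0
    have : Fact (Irreducible p) := ⟨hp⟩
    have hVz : AdjoinRoot.mkₐ p V = 0 := AdjoinRoot.mk_eq_zero.2 hpV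
    have hUz : AdjoinRoot.mkₐ p U = 0 := by rw [hUV, map_mul, hVz, mul_zero]
    rw [hU, map_formEval] at hUz
    rw [hV, map_formEval] at hVz
    have h0 : AdjoinRoot.mkₐ p A ≠ 0 ∨ AdjoinRoot.mkₐ p B ≠ 0 := by
      by_contra! h0
      obtain ⟨u, v, huv⟩ := hAB
      have := congrArg (AdjoinRoot.mkₐ p) huv
      simp only [map_add, map_mul, h0.1, h0.2, mul_zero, add_zero, map_one] at this
      exact zero_ne_one this
    rcases formEval_ne_zero_of_isCoprime hCD h0 with h1 | h1
    · exact h1 hUz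
    · exact h1 hVz
  have hUdeg : U.natDegree = 1 := by
    obtain ⟨c, hc, hcV⟩ := Polynomial.isUnit_iff.1 hunit
    rw [hUV, ← hcV, Polynomial.natDegree_mul_C hc.ne_zero, Polynomial.natDegree_X]
  have hle : 1 ≤ e * d := hUdeg ▸ natDegree_formEval_le (le_max_left _ _) (le_max_right _ _) e C
  have hcoeff : A.coeff d ≠ 0 ∨ B.coeff d ≠ 0 := by
    have := formEval_ne_zero_of_isCoprime (F := K) hAB (x := 1) (y := 0) (Or.inl one_ne_zero)
    simpa [formEval_zero_right] using this
  -- No degree is lost in the composition: the coefficients of `X ^ (e * d)` in `U` and `V` are the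
  -- two forms evaluated at the image of `∞`, so they do not both vanish.
  have hge : e * d ≤ 1 := by
    rcases formEval_ne_zero_of_isCoprime hCD hcoeff with h1 | h1
    · rw [← coeff_formEval (le_max_left _ _) (le_max_right _ _)] at h1
      exact hUdeg ▸ Polynomial.le_natDegree_of_ne_zero h1
    · rw [← coeff_formEval (le_max_left _ _) (le_max_right _ _)] at h1
      have := Polynomial.le_natDegree_of_ne_zero h1
      rw [← hV, Polynomial.natDegree_eq_zero_of_isUnit hunit] at this
      exact this.trans zero_le_one
  exact Nat.dvd_one.1 ⟨e, by rw [mul_comm]; exact le_antisymm hle hge⟩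

theorem crossRatio_ratMap {A B : Polynomial K} (hAB : IsCoprime A B)
    (hdeg : max A.natDegree B.natDegree = 1) (a b c d : OnePoint K) :
    crossRatio (ratMap A B a) (ratMap A B b) (ratMap A B c) (ratMap A B d) =
      crossRatio a b c d := by
  obtain ⟨a₁, a₂, ha, rfl⟩ := exists_projPoint a
  obtain ⟨b₁, b₂, hb, rfl⟩ := exists_projPoint b
  obtain ⟨c₁, c₂, hc, rfl⟩ := exists_projPoint c
  obtain ⟨d₁, d₂, hd, rfl⟩ := exists_projPoint d
  have hne : ∀ {x y : K}, (x ≠ 0 ∨ y ≠ 0) → formEval 1 A x y ≠ 0 ∨ formEval 1 B x y ≠ 0 :=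
    fun {x y} h => by
      have := formEval_ne_zero_of_isCoprime (F := K) hAB h
      rwa [hdeg] at this
  have hform : ∀ (P : Polynomial K) (x y : K),
      formEval 1 P x y = P.coeff 0 * y + P.coeff 1 * x := fun P x y => by
    simp [formEval, Finset.sum_range_succ]
  rw [ratMap_projPoint _ _ ha, ratMap_projPoint _ _ hb, ratMap_projPoint _ _ hc,
    ratMap_projPoint _ _ hd, hdeg, crossRatio_projPoint (hne ha) (hne hb) (hne hc) (hne hd),
    crossRatio_projPoint ha hb hc hd]
  set Δ := A.coeff 1 * B.coeff 0 - A.coeff 0 * B.coeff 1 with hΔ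
  -- If `Δ = 0`, both linear forms vanish at `(A.coeff 0, -A.coeff 1)` and at `(B.coeff 0, -B.coeff
  -- 1)`; by coprimality these vectors are zero, so both forms vanish identically.
  have hΔ0 : Δ ≠ 0 := by
    intro h0
    have h1 : A.coeff 0 = 0 ∧ A.coeff 1 = 0 := by
      by_contra hcon
      have h2 : A.coeff 0 ≠ 0 ∨ -A.coeff 1 ≠ 0 := by
        rw [neg_ne_zero]; tauto
      rcases hne h2 with h3 | h3
      · exact h3 (by rw [hform]; ring)
      · exact h3 (by rw [hform]; linear_combination -h0)
    rcases hne (x := B.coeff 0) (y := -B.coeff 1) (by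
      by_contra! hcon
      rw [neg_eq_zero] at hcon
      rcases hne (x := 1) (y := 0) (Or.inl one_ne_zero) with h3 | h3
      · exact h3 (by rw [hform, h1.1, h1.2]; ring)
      · exact h3 (by rw [hform, hcon.1, hcon.2]; ring)) with h3 | h3
    · exact h3 (by rw [hform]; linear_combination h0)
    · exact h3 (by rw [hform]; ring)
  rw [← mul_div_mul_left ((a₁ * c₂ - c₁ * a₂) * (b₁ * d₂ - d₁ * b₂)) _ (pow_ne_zero 2 hΔ0)]
  simp only [hform]
  congr 1 <;> rw [hΔ] <;> ring

end Moebius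

/-! ### Binary forms in the two basic theta functions exhaust the symmetric theta functions. -/

section ThetaBasis

variable {K : Type*} [NontriviallyNormedField K]

/-- The even symmetric theta function `∑ q ^ (j ^ 2) z ^ (2 j)` of degree two. -/
noncomputable def thetaEven (q z : Kˣ) : K := thetaSeries q (z ^ 2)

/-- The odd symmetric theta function `∑ q ^ (j ^ 2 + j) z ^ (2 j + 1)` of degree two. -/
noncomputable def thetaOdd (q z : Kˣ) : K := (z : K) * thetaSeries q (q * z ^ 2)

theorem thetaEven_neg (q z : Kˣ) : thetaEven q (-z) = thetaEven q z := by
  simp [thetaEven]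

theorem thetaOdd_neg (q z : Kˣ) : thetaOdd q (-z) = -thetaOdd q z := by
  simp [thetaOdd]

variable [IsUltrametricDist K] [CompleteSpace K]

theorem isSymmTheta_thetaEven {q : Kˣ} (hq : ‖(q : K)‖ < 1) : IsSymmTheta q 1 (thetaEven q) where
  holomorphic := (isLaurentSum_thetaSeries hq).isHolomorphicGm.comp_sq
  inv z := by
    unfold thetaEven
    rw [inv_pow, thetaSeries_inv hq]
  shift z := by
    unfold thetaEven
    have := thetaSeries_zpow_mul hq 1 (z ^ 2)
    rw [mul_pow, show q ^ 2 = q ^ (2 * 1 : ℤ) by norm_cast, this]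
    congr 2
    rw [← zpow_natCast z, ← zpow_mul]
    norm_num

theorem isSymmTheta_thetaOdd {q : Kˣ} (hq : ‖(q : K)‖ < 1) : IsSymmTheta q 1 (thetaOdd q) where
  holomorphic := by
    have := ((isLaurentSum_thetaSeries hq).isHolomorphicGm.comp_mul q).comp_sq.zpow_mul 1
    simp only [zpow_one] at this
    exact this
  inv z := by
    unfold thetaOdd
    have h1 := thetaSeries_zpow_mul hq (-1) (q * z ^ 2)
    have h2 := thetaSeries_inv hq (q * (z⁻¹) ^ 2)
    rw [← h2, show (q * z⁻¹ ^ 2)⁻¹ = q ^ (2 * -1 : ℤ) * (q * z ^ 2) by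
      rw [← mul_assoc, ← zpow_add_one]; simp [mul_comm], h1, ← mul_assoc, ← Units.val_mul]
    congr 2
    rw [neg_neg, zpow_one, ← mul_assoc]
    simp [pow_two]
  shift z := by
    unfold thetaOdd
    have := thetaSeries_zpow_mul hq 1 (q * z ^ 2)
    rw [show q * (q * z) ^ 2 = q ^ (2 * 1 : ℤ) * (q * z ^ 2) by
      rw [mul_pow, mul_left_comm]; norm_cast, this, ← mul_assoc, ← mul_assoc, ← Units.val_mul,
      ← Units.val_mul]
    congr 2
    simp only [zpow_neg, zpow_one, one_pow, mul_one, mul_inv]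
    refine Units.ext ?_
    push_cast
    field_simp

theorem thetaEven_one_ne_zero {q : Kˣ} (hq : ‖(q : K)‖ < 1) : thetaEven q 1 ≠ 0 := by
  have := norm_thetaSeries_one hq
  rw [← norm_pos_iff, thetaEven, one_pow, this]
  exact one_pos

theorem thetaOdd_one_ne_zero (h2 : (2 : K) ≠ 0) {q : Kˣ} (hq : ‖(q : K)‖ < 1) :
    thetaOdd q 1 ≠ 0 := by
  obtain ⟨u, hu, h⟩ := thetaSeries_self_eq hq
  rw [thetaOdd, one_pow, mul_one, h, Units.val_one, one_mul]
  exact mul_ne_zero h2 (norm_pos_iff.1 (hu ▸ one_pos))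

theorem IsHolomorphicGm.exists_eq_zero_of_prod {ι : Type*} (s : Finset ι) {f : ι → Kˣ → K}
    (hf : ∀ i ∈ s, IsHolomorphicGm (f i)) (h : ∀ z, ∏ i ∈ s, f i z = 0) : ∃ i ∈ s, f i = 0 := by
  classical
  have hprod : ∀ s : Finset ι, (∀ i ∈ s, IsHolomorphicGm (f i)) →
      IsHolomorphicGm (fun z => ∏ i ∈ s, f i z) := fun s => by
    induction s using Finset.induction_on with
    | empty => intro _; simpa only [Finset.prod_empty] using IsHolomorphicGm.const (K := K) 1
    | insert i s hi ih =>
      intro hs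
      simp only [Finset.prod_insert hi]
      exact (hs i (by simp)).mul (ih fun j hj => hs j (by simp [hj]))
  induction s using Finset.induction_on with
  | empty => simpa using h 1
  | insert i s hi ih =>
    simp only [Finset.prod_insert hi] at h
    rcases (hf i (by simp)).eq_zero_or_eq_zero_of_mul (hprod s fun j hj => hf j (by simp [hj])) h
      with h0 | h0
    · exact ⟨i, by simp, h0⟩
    · obtain ⟨j, hj, hj0⟩ := ih (fun j hj => hf j (by simp [hj])) fun z => congrFun h0 z
      exact ⟨j, by simp [hj], hj0⟩

/-- If only finitely many values `v` occurred, the product of all `Y * (X - v * Y)` would vanish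
identically, hence so would one factor, the ring being a domain. Its values at `1` and `-1`, where
`X` is even and `Y` odd, give `2 * X(1) = 0`. The infinitude of values yields the independence of
the monomials in `X`, `Y`. -/
theorem infinite_thetaEven_div_thetaOdd (h2 : (2 : K) ≠ 0) {q : Kˣ} (hq : ‖(q : K)‖ < 1) :
    {x : K | ∃ z, thetaOdd q z ≠ 0 ∧ thetaEven q z / thetaOdd q z = x}.Infinite := by
  intro hfin
  have hX := (isSymmTheta_thetaEven hq).holomorphic
  have hY := (isSymmTheta_thetaOdd hq).holomorphic
  have hX1 := thetaEven_one_ne_zero hq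
  have hY1 := thetaOdd_one_ne_zero h2 hq
  have hprod := IsHolomorphicGm.exists_eq_zero_of_prod hfin.toFinset
    (f := fun v z => thetaOdd q z * (thetaEven q z - v * thetaOdd q z))
    (fun v _ => hY.mul (hX.sub (hY.const_mul v))) fun z => by
      rw [Finset.prod_eq_zero_iff]
      by_cases hz : thetaOdd q z = 0
      · exact ⟨thetaEven q 1 / thetaOdd q 1, by simpa using ⟨1, hY1, rfl⟩, by simp [hz]⟩
      · refine ⟨thetaEven q z / thetaOdd q z, by simpa using ⟨z, hz, rfl⟩, ?_⟩
        rw [div_mul_cancel₀ _ hz, sub_self, mul_zero]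
  obtain ⟨v, -, hv⟩ := hprod
  have e1 := congrFun hv 1
  have e2 := congrFun hv (-1)
  simp only [thetaEven_neg, thetaOdd_neg, Pi.zero_apply, mul_eq_zero, neg_eq_zero, hY1,
    false_or] at e1 e2
  have : 2 * thetaEven q 1 = 0 := by linear_combination e1 + e2
  exact (mul_ne_zero h2 hX1) this

theorem isSymmTheta_monomial {q : Kˣ} (hq : ‖(q : K)‖ < 1) {i e : ℕ} (hi : i ≤ e) :
    IsSymmTheta q e (fun z => thetaEven q z ^ i * thetaOdd q z ^ (e - i)) := by
  have := ((isSymmTheta_thetaEven hq).pow i).mul ((isSymmTheta_thetaOdd hq).pow (e - i))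
  rwa [mul_one, mul_one, ← Nat.cast_add, Nat.add_sub_cancel' hi] at this

theorem eq_zero_of_formEval_theta_eq_zero (h2 : (2 : K) ≠ 0) {q : Kˣ} (hq : ‖(q : K)‖ < 1) {e : ℕ}
    {P : Polynomial K} (hP : P.natDegree ≤ e)
    (h : ∀ z, formEval e P (thetaEven q z) (thetaOdd q z) = 0) : P = 0 := by
  refine Polynomial.eq_zero_of_infinite_isRoot _
    ((infinite_thetaEven_div_thetaOdd h2 hq).mono ?_)
  rintro _ ⟨z, hz, rfl⟩
  have := h z
  rw [formEval_of_ne_zero hP _ hz, mul_eq_zero] at this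
  simpa using this.resolve_left (pow_ne_zero _ hz)

/-- Every symmetric theta function is a form in the two basic ones. -/
theorem IsSymmTheta.exists_form (h2 : (2 : K) ≠ 0) {q : Kˣ} (hq : ‖(q : K)‖ < 1) {e : ℕ}
    {f : Kˣ → K} (hf : IsSymmTheta q e f) :
    ∃ P : Polynomial K, P.natDegree ≤ e ∧
      ∀ z, f z = formEval e P (thetaEven q z) (thetaOdd q z) := by
  have hmon : ∀ i : Fin (e + 1), IsSymmTheta q e
      (fun z => thetaEven q z ^ (i : ℕ) * thetaOdd q z ^ (e - i)) := fun i =>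
    isSymmTheta_monomial hq (Nat.lt_succ_iff.1 i.2)
  choose A hA using fun i => (hmon i).holomorphic
  have hlin : ∀ c : Fin (e + 1) → K, IsLaurentSum (fun n => ∑ i, c i * A i n) (fun z => ∑ i,
      c i * (thetaEven q z ^ (i : ℕ) * thetaOdd q z ^ (e - i))) := fun c =>
    IsLaurentSum.sum _ fun i _ => IsLaurentSum.const_mul (c i) (hA i)
  have hsymm : ∀ c : Fin (e + 1) → K, IsSymmTheta q e (fun z => ∑ i,
      c i * (thetaEven q z ^ (i : ℕ) * thetaOdd q z ^ (e - i))) := fun c =>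
    IsSymmTheta.sum _ fun i _ => (hmon i).const_mul (c i)
  -- the polynomial with given coefficients
  set poly : (Fin (e + 1) → K) → Polynomial K := fun c =>
    ∑ i : Fin (e + 1), Polynomial.monomial (i : ℕ) (c i) with hpoly
  have hcoeff : ∀ c (i : Fin (e + 1)), (poly c).coeff i = c i := fun c i => by
    simp only [hpoly, Polynomial.finsetSum_coeff, Polynomial.coeff_monomial]
    simp [← Fin.ext_iff]
  have hdeg : ∀ c, (poly c).natDegree ≤ e := fun c =>
    Polynomial.natDegree_sum_le_of_forall_le _ _ fun i _ =>
      (Polynomial.natDegree_monomial_le _).trans (Nat.lt_succ_iff.1 i.2)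
  have hform : ∀ c z, formEval e (poly c) (thetaEven q z) (thetaOdd q z) =
      ∑ i, c i * (thetaEven q z ^ (i : ℕ) * thetaOdd q z ^ (e - i)) := fun c z => by
    rw [formEval, ← Fin.sum_univ_eq_sum_range (fun i => algebraMap K K ((poly c).coeff i) *
      thetaEven q z ^ i * thetaOdd q z ^ (e - i))]
    exact Finset.sum_congr rfl fun i _ => by rw [hcoeff, mul_assoc]; rfl
  set M : Matrix (Fin (e + 1)) (Fin (e + 1)) K := Matrix.of fun j i => A i ((j : ℕ) : ℤ) with hM
  have hMv : ∀ c j, M.mulVec c j = ∑ i, c i * A i ((j : ℕ) : ℤ) := fun c j => by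
    simp [hM, Matrix.mulVec, dotProduct, mul_comm]
  -- A combination of monomials with vanishing coefficients `0, …, e` is zero, and the monomials are
  -- independent. The matrix is square, so it is also surjective: a suitable form matches the first
  -- `e + 1` coefficients of `f`, and therefore all of them.
  have hinj : Function.Injective M.mulVec := by
    have : Function.Injective M.mulVecLin := by
      refine (injective_iff_map_eq_zero _).2 fun c hc => ?_
      have h0 := (hsymm c).coeff_eq_zero hq (hlin c) fun k hk => by
        have := congrFun hc ⟨k, Nat.lt_succ_of_le hk⟩
        rw [Matrix.mulVecLin_apply, hMv] at this
        simpa using this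
      have hl := hlin c
      rw [h0] at hl
      have hz := hl.eq_zero_of_coeff
      have hp := eq_zero_of_formEval_theta_eq_zero h2 hq (hdeg c) fun z => by
        rw [hform]; exact congrFun hz z
      funext i
      rw [← hcoeff c i, hp]; simp
    rwa [Matrix.coe_mulVecLin] at this
  have hsurj : Function.Surjective M.mulVec :=
    Matrix.mulVec_surjective_iff_isUnit.2 (Matrix.mulVec_injective_iff_isUnit.1 hinj)
  obtain ⟨a, ha : IsLaurentSum a f⟩ := hf.holomorphic
  obtain ⟨c, hc⟩ := hsurj fun j => a ((j : ℕ) : ℤ)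
  refine ⟨poly c, hdeg c, fun z => ?_⟩
  have hdiff : IsSymmTheta q e (fun z => f z + -1 * ∑ i,
      c i * (thetaEven q z ^ (i : ℕ) * thetaOdd q z ^ (e - i))) := hf.add ((hsymm c).const_mul (-1))
  have hl := ha.add ((hlin c).const_mul (-1))
  have h0 := hdiff.coeff_eq_zero hq hl fun k hk => by
    have := congrFun hc ⟨k, Nat.lt_succ_of_le hk⟩
    rw [hMv] at this
    simp only at this
    rw [this]; ring
  rw [h0] at hl
  have := congrFun hl.eq_zero_of_coeff z
  rw [hform]
  simp only [Pi.zero_apply] at this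
  linear_combination this

end ThetaBasis

/-! ### An explicit Bézout identity for the two theta functions. -/

section Bezout

/-- The triangular number `n (n + 1) / 2`. -/
def triangular (n : ℤ) : ℤ := n * (n + 1) / 2

theorem two_mul_triangular (n : ℤ) : 2 * triangular n = n * (n + 1) :=
  Int.mul_ediv_cancel' (Int.even_mul_succ_self n).two_dvd

theorem triangular_neg_sub_one (n : ℤ) : triangular (-n - 1) = triangular n := by
  have h1 := two_mul_triangular (-n - 1)
  have h2 := two_mul_triangular n
  linarith

variable {K : Type*} [NontriviallyNormedField K]

theorem val_zpow_ne_one {q : Kˣ} (hq : ‖(q : K)‖ < 1) {j : ℤ} (hj : j ≠ 0) :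
    ((q ^ j : Kˣ) : K) ≠ 1 := fun h => by
  have h1 := congrArg norm h
  rw [Units.val_zpow_eq_zpow_val, norm_zpow, norm_one,
    zpow_eq_one_iff_right₀ (norm_nonneg _) hq.ne] at h1
  exact hj h1

theorem norm_neg_one_pow_mul_zpow (q : Kˣ) (m : ℕ) (n : ℤ) :
    ‖(((-1) ^ m * q ^ n : Kˣ) : K)‖ = ‖(q : K)‖ ^ n := by
  rw [Units.val_mul, norm_mul, Units.val_zpow_eq_zpow_val, norm_zpow]
  simp

/-- The tail `∑_{j ≥ m} (-1) ^ j q ^ (j (j + 1) / 2)` of a theta series at a zero. -/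
noncomputable def thetaTail (q : Kˣ) (m : ℕ) : K :=
  ∑' i : ℕ, (((-1) ^ (m + i) * q ^ triangular (m + i : ℕ) : Kˣ) : K)

variable [IsUltrametricDist K] [CompleteSpace K]

theorem hasSum_thetaTail {q : Kˣ} (hq : ‖(q : K)‖ < 1) (m : ℕ) :
    HasSum (fun i : ℕ => (((-1) ^ (m + i) * q ^ triangular (m + i : ℕ) : Kˣ) : K))
      (thetaTail q m) := by
  have hq0 : 0 < ‖(q : K)‖ := norm_pos_iff.2 q.ne_zero
  refine ((summable_geometric_of_norm_lt_one hq).of_norm_le_of_ultrametric fun i => ?_).hasSum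
  rw [norm_neg_one_pow_mul_zpow, norm_pow, ← zpow_natCast]
  refine zpow_le_zpow_right_of_le_one₀ hq0 hq.le ?_
  have := two_mul_triangular (m + i : ℕ)
  push_cast at this ⊢
  nlinarith [Int.natCast_nonneg m, Int.natCast_nonneg i, mul_nonneg (Int.natCast_nonneg m)
    (Int.natCast_nonneg i), Int.le_self_sq i, sq_nonneg (m : ℤ)]

theorem thetaTail_eq_add {q : Kˣ} (hq : ‖(q : K)‖ < 1) (m : ℕ) :
    thetaTail q m = (((-1) ^ m * q ^ triangular m : Kˣ) : K) + thetaTail q (m + 1) := by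
  have h := (hasSum_thetaTail hq (m + 1)).congr_terms
    (g := fun i : ℕ => (((-1) ^ (m + (i + 1)) * q ^ triangular (m + (i + 1) : ℕ) : Kˣ) : K))
    fun i => by rw [add_right_comm, add_assoc]
  exact (hasSum_thetaTail hq m).unique
    (HasSum.zero_add (f := fun i : ℕ =>
      (((-1) ^ (m + i) * q ^ triangular (m + i : ℕ) : Kˣ) : K)) h)

theorem norm_thetaTail_le {q : Kˣ} (hq : ‖(q : K)‖ < 1) (m : ℕ) :
    ‖thetaTail q m‖ ≤ ‖(q : K)‖ ^ triangular m := by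
  have hq0 : 0 < ‖(q : K)‖ := norm_pos_iff.2 q.ne_zero
  refine (hasSum_thetaTail hq m).norm_le_of_ultrametric (by positivity) fun i => ?_
  rw [norm_neg_one_pow_mul_zpow]
  refine zpow_le_zpow_right_of_le_one₀ hq0 hq.le ?_
  have h1 := two_mul_triangular (m + i : ℕ)
  have h2 := two_mul_triangular m
  push_cast at h1 ⊢
  nlinarith [Int.natCast_nonneg m, Int.natCast_nonneg i]

theorem norm_thetaTail_zero {q : Kˣ} (hq : ‖(q : K)‖ < 1) : ‖thetaTail q 0‖ = 1 := by
  have hq0 : 0 < ‖(q : K)‖ := norm_pos_iff.2 q.ne_zero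
  have := (hasSum_thetaTail hq 0).norm_eq_of_dominant (i := 0) (Units.ne_zero _) fun j hj => ?_
  · rw [this]; simp [triangular]
  · rw [norm_neg_one_pow_mul_zpow, norm_neg_one_pow_mul_zpow]
    refine zpow_lt_zpow_right_of_lt_one₀ hq0 hq ?_
    have h1 := two_mul_triangular (0 + j : ℕ)
    have h2 : (0 : ℤ) < j := by exact_mod_cast Nat.pos_of_ne_zero hj
    rw [zero_add] at h1
    rw [zero_add j, show triangular ((0 + 0 : ℕ) : ℤ) = 0 by simp [triangular]]
    nlinarith

/-- Under `j ↦ -1 - j` the triangular number is fixed and the sign `(-1) ^ j` changes, so the terms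
from `-m` to `m - 1` cancel and the tail from `-m` equals the tail from `m`. This is why the
absolute value of the index gives one formula on both sides of zero. -/
theorem thetaTail_natAbs_sub {q : Kˣ} (hq : ‖(q : K)‖ < 1) (n : ℤ) :
    thetaTail q n.natAbs - thetaTail q (n - 1).natAbs =
      (((-1) ^ n * q ^ triangular (n - 1) : Kˣ) : K) := by
  rcases lt_or_ge 0 n with hn | hn
  · obtain ⟨m, rfl⟩ : ∃ m : ℕ, n = m + 1 := ⟨(n - 1).toNat, by omega⟩
    rw [add_sub_cancel_right, Int.natAbs_natCast, show ((m : ℤ) + 1).natAbs = m + 1 by omega,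
      thetaTail_eq_add hq m, show ((m : ℤ) + 1) = ((m + 1 : ℕ) : ℤ) by push_cast; rfl,
      zpow_natCast, pow_succ]
    push_cast
    ring
  · obtain ⟨m, rfl⟩ : ∃ m : ℕ, n = -m := ⟨(-n).toNat, by omega⟩
    rw [triangular_neg_sub_one, Int.natAbs_neg, Int.natAbs_natCast,
      show (-(m : ℤ) - 1).natAbs = m + 1 by omega, thetaTail_eq_add hq m, zpow_neg, zpow_natCast]
    have : ((-1 : Kˣ) ^ m)⁻¹ = (-1) ^ m := by rw [← inv_pow]; simp
    rw [this]
    ring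

/-- The alternating theta series vanishes at the powers of `q`. -/
theorem hasSum_alternating_theta_zero (h2 : (2 : K) ≠ 0) {q : Kˣ} (hq : ‖(q : K)‖ < 1) (j : ℤ) :
    HasSum (fun n : ℤ => (((-1) ^ n * q ^ triangular (n - 1) : Kˣ) : K) *
      ((q ^ (n * j) : Kˣ) : K)) 0 := by
  have hsum : Summable (fun n : ℤ => (((-1) ^ n * q ^ triangular (n - 1) : Kˣ) : K) *
      ((q ^ (n * j) : Kˣ) : K)) := by
    refine summable_of_quadratic_decay hq (q ^ j) (E := fun n => triangular (n - 1)) (D := 2)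
      (fun n => ?_) fun n => ?_
    · have := two_mul_triangular (n - 1)
      have := le_abs_self n
      have := abs_nonneg n
      push_cast
      nlinarith
    · rw [norm_mul, Units.val_mul, norm_mul, Units.val_zpow_eq_zpow_val q, norm_zpow, ← zpow_mul,
        mul_comm j n]
      simp [Units.val_zpow_eq_zpow_val]
  have h1 := hsum.hasSum
  -- The reflection `n ↦ 1 - 2 j - n` preserves the exponent of `q` and reverses the sign, so the
  -- sum equals its own negative.
  have hs := ((Equiv.subLeft (1 - 2 * j)).hasSum_iff.2 h1).unique (h1.neg.congr_terms fun n => by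
    simp only [Function.comp, Equiv.subLeft_apply]
    have e1 : (-1 : Kˣ) ^ (1 - 2 * j - n) = -(-1) ^ n := by
      rw [show 1 - 2 * j - n = 1 + 2 * (-j) + -n by ring, zpow_add, zpow_add, zpow_mul,
        ← inv_zpow' _ n]
      simp
    have e2 : triangular (1 - 2 * j - n - 1) + (1 - 2 * j - n) * j =
        triangular (n - 1) + n * j := by
      have := two_mul_triangular (1 - 2 * j - n - 1)
      have := two_mul_triangular (n - 1)
      nlinarith
    rw [← Units.val_mul, ← Units.val_mul, mul_assoc, mul_assoc, ← zpow_add, ← zpow_add, e1, e2,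
      neg_mul, Units.val_neg])
  have : 2 * ∑' n : ℤ, (((-1) ^ n * q ^ triangular (n - 1) : Kˣ) : K) *
      ((q ^ (n * j) : Kˣ) : K) = 0 := by linear_combination hs
  rw [(mul_eq_zero.1 this).resolve_left h2] at h1
  exact h1

theorem two_mul_triangular_abs (n : ℤ) : 2 * triangular |n| = n ^ 2 + |n| := by
  rw [two_mul_triangular, ← sq_abs]
  ring

theorem summable_thetaTail_mul {q : Kˣ} (hq : ‖(q : K)‖ < 1) (j : ℤ) :
    Summable fun n : ℤ => thetaTail q n.natAbs * ((q ^ (n * j) : Kˣ) : K) := by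
  refine summable_of_quadratic_decay hq (q ^ j) (E := fun n => triangular n.natAbs) (D := 2)
    (fun n => ?_) fun n => ?_
  · have := two_mul_triangular_abs n
    have := abs_nonneg n
    push_cast
    linarith
  · rw [norm_mul, ← zpow_mul, mul_comm j n]
    gcongr
    exact norm_thetaTail_le hq _

/-- Summation by parts: `(1 - q ^ j)` times the sum is the alternating theta series at `q ^ j`,
which vanishes, while `q ^ j ≠ 1`. -/
theorem hasSum_thetaTail_mul_zero (h2 : (2 : K) ≠ 0) {q : Kˣ} (hq : ‖(q : K)‖ < 1) {j : ℤ}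
    (hj : j ≠ 0) :
    HasSum (fun n : ℤ => thetaTail q n.natAbs * ((q ^ (n * j) : Kˣ) : K)) 0 := by
  have h := (summable_thetaTail_mul hq j).hasSum
  set S := ∑' n : ℤ, thetaTail q n.natAbs * ((q ^ (n * j) : Kˣ) : K) with hS
  have h' := ((Equiv.subRight (1 : ℤ)).hasSum_iff.2 h).mul_right ((q ^ j : Kˣ) : K)
  have hd := (h.sub h').unique ((hasSum_alternating_theta_zero h2 hq j).congr_terms fun n => by
    simp only [Function.comp, Equiv.subRight_apply]
    rw [← thetaTail_natAbs_sub hq, mul_assoc, ← Units.val_mul, ← zpow_add,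
      show (n - 1) * j + j = n * j by ring]
    ring)
  have hd' : (1 - ((q ^ j : Kˣ) : K)) * S = 0 := by linear_combination hd
  rw [(mul_eq_zero.1 hd').resolve_left (sub_ne_zero.2 (val_zpow_ne_one hq hj).symm)] at h
  exact h

/-- Expanding the theta series and exchanging the sums makes the coefficient of `w ^ j` a multiple
of `∑ thetaTail q |n| * q ^ (n j)`, which vanishes for `j ≠ 0`; only a constant survives. It is
nonzero since its term `n = 0` has absolute value `1` and all others are smaller. -/
theorem exists_hasSum_thetaTail_mul_thetaSeries (h2 : (2 : K) ≠ 0) {q : Kˣ}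
    (hq : ‖(q : K)‖ < 1) : ∃ S : K, S ≠ 0 ∧ ∀ w : Kˣ,
      HasSum (fun n : ℤ => thetaTail q n.natAbs * thetaSeries q (q ^ n * w)) S := by
  have hq0 : 0 < ‖(q : K)‖ := norm_pos_iff.2 q.ne_zero
  have h0 := (summable_thetaTail_mul hq 0).hasSum
  set S := ∑' n : ℤ, thetaTail q n.natAbs * ((q ^ (n * 0) : Kˣ) : K) with hS
  refine ⟨S, fun hz => ?_, fun w => ?_⟩
  · have h1 := norm_thetaTail_zero hq
    have hne : thetaTail q 0 ≠ 0 := norm_pos_iff.1 (h1 ▸ one_pos)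
    have := h0.norm_eq_of_dominant (i := 0) (by simpa using hne) fun n hn => ?_
    · rw [hz] at this
      simp [h1] at this
    · simp only [mul_zero, zpow_zero, Units.val_one, mul_one, Int.natAbs_zero, h1]
      refine (norm_thetaTail_le hq _).trans_lt (zpow_lt_one₀ hq0 hq ?_)
      have := two_mul_triangular_abs n
      have := abs_pos.2 hn
      rw [← Int.abs_eq_natAbs]
      nlinarith [sq_nonneg n]
  · have hsum : Summable fun p : ℤ × ℤ => thetaTail q p.1.natAbs *
        ((q ^ (p.2 ^ 2) * (q ^ p.1 * w) ^ p.2 : Kˣ) : K) := by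
      refine summable_of_quadratic_decay₂ hq w
        (E := fun p => triangular p.1.natAbs + p.2 ^ 2 + p.1 * p.2) (D := 8) (fun p => ?_)
        fun p => ?_
      · have := two_mul_triangular_abs p.1
        have := abs_nonneg p.1
        have := abs_nonneg p.2
        push_cast
        nlinarith [sq_nonneg (3 * p.1 + 4 * p.2), sq_nonneg p.2]
      · rw [mul_zpow, ← zpow_mul, ← mul_assoc, ← zpow_add, norm_mul, Units.val_mul, norm_mul,
          Units.val_zpow_eq_zpow_val q, norm_zpow, ← mul_assoc, add_assoc, zpow_add₀ hq0.ne' (triangular _)]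
        gcongr
        exact norm_thetaTail_le hq _
    have h1 := hsum.hasSum.prod_fiberwise fun n =>
      (hasSum_thetaSeries hq (q ^ n * w)).mul_left (thetaTail q n.natAbs)
    have h3 := ((Equiv.prodComm ℤ ℤ).hasSum_iff.2 hsum.hasSum).prod_fiberwise
      (g := Pi.single 0 S) fun j => by
        have hterm : ∀ n : ℤ, thetaTail q n.natAbs * ((q ^ (n * j) : Kˣ) : K) *
            ((q ^ (j ^ 2) * w ^ j : Kˣ) : K) = thetaTail q n.natAbs *
              ((q ^ (j ^ 2) * (q ^ n * w) ^ j : Kˣ) : K) := fun n => by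
          rw [mul_assoc, ← Units.val_mul, mul_zpow, ← zpow_mul]
          congr 2
          exact mul_left_comm _ _ _
        by_cases hj : j = 0
        · subst hj
          have := (h0.mul_right ((q ^ ((0 : ℤ) ^ 2) * w ^ (0 : ℤ) : Kˣ) : K)).congr_terms hterm
          simpa using this
        · have := ((hasSum_thetaTail_mul_zero h2 hq hj).mul_right
            ((q ^ (j ^ 2) * w ^ j : Kˣ) : K)).congr_terms hterm
          rw [zero_mul] at this
          rw [Pi.single_eq_of_ne hj]
          exact this
    rw [← h3.unique (hasSum_pi_single 0 S)]
    exact h1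

/-- The basic theta functions generate the unit ideal in the ring of holomorphic functions. -/
theorem exists_bezout_theta (h2 : (2 : K) ≠ 0) {q : Kˣ} (hq : ‖(q : K)‖ < 1) :
    ∃ a b : Kˣ → K, IsHolomorphicGm a ∧ IsHolomorphicGm b ∧
      ∀ z, a z * thetaEven q z + b z * thetaOdd q z = 1 := by
  have hq0 : 0 < ‖(q : K)‖ := norm_pos_iff.2 q.ne_zero
  obtain ⟨S, hS, hsum⟩ := exists_hasSum_thetaTail_mul_thetaSeries h2 hq
  -- Even translates `θ(q ^ (2k) w)` are monomials times `θ(w)`, odd ones are monomials times `θ(q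
  -- w)`. Hence the constant series above, split by parity, is already a Bézout relation; `α` and
  -- `β` collect its coefficients, and the tails decay fast enough to outweigh the negative powers
  -- of `q`.
  set α : ℤ → K := fun k => thetaTail q (2 * k).natAbs * ((q ^ (-k ^ 2) : Kˣ) : K) with hα
  set β : ℤ → K := fun k => thetaTail q (2 * k + 1).natAbs * ((q ^ (-k ^ 2 - k) : Kˣ) : K) with hβ
  have hA : IsLaurentSum α (fun z => ∑' k : ℤ, α k * ((z ^ k : Kˣ) : K)) := fun z => by
    refine (summable_of_quadratic_decay hq z
      (E := fun k => triangular (2 * k).natAbs + (-k ^ 2)) (D := 1) (fun k => ?_)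
      fun k => ?_).hasSum
    · have := two_mul_triangular_abs (2 * k)
      have := abs_nonneg k
      have := abs_nonneg (2 * k)
      push_cast
      nlinarith
    · rw [norm_mul, norm_mul, Units.val_zpow_eq_zpow_val q, norm_zpow, zpow_add₀ hq0.ne']
      gcongr
      exact norm_thetaTail_le hq _
  have hB : IsLaurentSum β (fun z => ∑' k : ℤ, β k * ((z ^ k : Kˣ) : K)) := fun z => by
    refine (summable_of_quadratic_decay hq z
      (E := fun k => triangular (2 * k + 1).natAbs + (-k ^ 2 - k)) (D := 2) (fun k => ?_)
      fun k => ?_).hasSum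
    · have := two_mul_triangular_abs (2 * k + 1)
      have := neg_abs_le k
      have := abs_nonneg k
      have := abs_nonneg (2 * k + 1)
      push_cast
      nlinarith [sq_nonneg k]
    · rw [norm_mul, norm_mul, Units.val_zpow_eq_zpow_val q, norm_zpow, zpow_add₀ hq0.ne']
      gcongr
      exact norm_thetaTail_le hq _
  have hA' := hA.comp_inv.isHolomorphicGm.comp_sq
  -- The extra `z⁻¹` cancels the factor `z` in `thetaOdd`.
  have hB' := hB.comp_inv.isHolomorphicGm.comp_sq.zpow_mul (-1)
  refine ⟨_, _, hA'.const_mul S⁻¹, hB'.const_mul S⁻¹, fun z => ?_⟩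
  have heven := ((hA (z ^ 2)⁻¹).mul_right (thetaEven q z)).congr_terms
    (g := fun k => thetaTail q (2 * k).natAbs * thetaSeries q (q ^ (2 * k) * z ^ 2)) fun k => by
      rw [thetaSeries_zpow_mul hq, ← mul_assoc, hα, mul_assoc (thetaTail _ _), ← Units.val_mul,
        inv_zpow']
      rfl
  have hodd := ((hB (z ^ 2)⁻¹).mul_right (thetaSeries q (q * z ^ 2))).congr_terms
    (g := fun k => thetaTail q (2 * k + 1).natAbs * thetaSeries q (q ^ (2 * k + 1) * z ^ 2))
    fun k => by
      rw [zpow_add_one, mul_assoc, mul_assoc (q ^ _), thetaSeries_zpow_mul hq, ← mul_assoc, hβ,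
        mul_assoc (thetaTail _ _), ← Units.val_mul, inv_zpow', mul_zpow,
        ← mul_assoc (q ^ (-k ^ 2)), ← zpow_add, sub_eq_add_neg, mul_assoc (thetaTail _ _)]
  have htot := (heven.int_even_add_odd
    (f := fun n => thetaTail q n.natAbs * thetaSeries q (q ^ n * z ^ 2)) hodd).unique
    (hsum (z ^ 2))
  have hz : ((z ^ (-1 : ℤ) : Kˣ) : K) * (z : K) = 1 := by
    rw [← Units.val_mul]; simp
  simp only [thetaOdd]
  have hSS : S⁻¹ * S = 1 := inv_mul_cancel₀ hS
  linear_combination S⁻¹ * htot + hSS + S⁻¹ * (∑' k : ℤ, β k * (((z ^ 2)⁻¹ ^ k : Kˣ) : K)) *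
    thetaSeries q (q * z ^ 2) * hz

end Bezout

/-! ### The quotient map and its universal property. -/

section Quotient

variable {K : Type*} [NontriviallyNormedField K] [IsUltrametricDist K] [CompleteSpace K]

/-- The quotient map of the Tate curve by inversion, given by the two basic theta functions. -/
noncomputable def thetaQuotient (q : Kˣ) (P : TateCurve q) : OnePoint K :=
  projPoint (thetaEven q P.out) (thetaOdd q P.out)

theorem projPoint_theta_zpow_mul {q : Kˣ} (hq : ‖(q : K)‖ < 1) (n : ℤ) (z : Kˣ) :
    projPoint (thetaEven q (q ^ n * z)) (thetaOdd q (q ^ n * z)) =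
      projPoint (thetaEven q z) (thetaOdd q z) := by
  have hstep : ∀ z : Kˣ, projPoint (thetaEven q (q * z)) (thetaOdd q (q * z)) =
      projPoint (thetaEven q z) (thetaOdd q z) := fun z => by
    rw [(isSymmTheta_thetaEven hq).shift, (isSymmTheta_thetaOdd hq).shift,
      projPoint_mul (Units.ne_zero _)]
  induction n using Int.induction_on with
  | zero => simp
  | succ n ih => rw [zpow_add_one, mul_comm (q ^ _) q, mul_assoc, hstep, ih]
  | pred n ih => rw [← ih, ← hstep, ← mul_assoc, ← zpow_one_add, add_sub_cancel]

theorem thetaQuotient_mk {q : Kˣ} (hq : ‖(q : K)‖ < 1) (z : Kˣ) :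
    thetaQuotient q (QuotientGroup.mk z) = projPoint (thetaEven q z) (thetaOdd q z) := by
  obtain ⟨⟨_, n, rfl⟩, h⟩ := QuotientGroup.mk_out_eq_mul (Subgroup.zpowers q) z
  unfold thetaQuotient
  rw [h, mul_comm]
  exact projPoint_theta_zpow_mul hq n z

theorem thetaEven_ne_zero_or (h2 : (2 : K) ≠ 0) {q : Kˣ} (hq : ‖(q : K)‖ < 1) (z : Kˣ) :
    thetaEven q z ≠ 0 ∨ thetaOdd q z ≠ 0 := by
  obtain ⟨a, b, -, -, hab⟩ := exists_bezout_theta h2 hq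
  by_contra! h
  have := hab z
  simp [h.1, h.2] at this

theorem isAnalyticToP1_thetaQuotient (h2 : (2 : K) ≠ 0) {q : Kˣ} (hq : ‖(q : K)‖ < 1) :
    IsAnalyticToP1 (thetaQuotient q) := by
  obtain ⟨a, b, ha, hb, hab⟩ := exists_bezout_theta h2 hq
  exact ⟨thetaEven q, thetaOdd q, (isSymmTheta_thetaEven hq).holomorphic,
    (isSymmTheta_thetaOdd hq).holomorphic, ⟨a, b, ha, hb, hab⟩, thetaQuotient_mk hq⟩

theorem thetaQuotient_inv {q : Kˣ} (hq : ‖(q : K)‖ < 1) (P : TateCurve q) :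
    thetaQuotient q P⁻¹ = thetaQuotient q P := by
  induction P using QuotientGroup.induction_on with
  | H z =>
    rw [← QuotientGroup.mk_inv, thetaQuotient_mk hq, thetaQuotient_mk hq,
      (isSymmTheta_thetaEven hq).inv, (isSymmTheta_thetaOdd hq).inv]

/-- Two polynomials of degree at most `e`, not both zero, are multiples of coprime ones. -/
theorem exists_isCoprime_factorization {F : Type*} [Field F] {P Q : Polynomial F} {e : ℕ}
    (hP : P.natDegree ≤ e) (hQ : Q.natDegree ≤ e) (h : P ≠ 0 ∨ Q ≠ 0) :
    ∃ D A B : Polynomial F, IsCoprime A B ∧ P = D * A ∧ Q = D * B ∧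
      D.natDegree + max A.natDegree B.natDegree ≤ e := by
  classical
  set D := EuclideanDomain.gcd P Q with hD
  have hD0 : D ≠ 0 := fun h0 => by
    rw [hD, EuclideanDomain.gcd_eq_zero_iff] at h0
    tauto
  have hDP : D ∣ P := EuclideanDomain.gcd_dvd_left P Q
  have hDQ : D ∣ Q := EuclideanDomain.gcd_dvd_right P Q
  have hab : D = P * EuclideanDomain.gcdA P Q + Q * EuclideanDomain.gcdB P Q :=
    EuclideanDomain.gcd_eq_gcd_ab P Q
  obtain ⟨A, hA⟩ := id hDP
  obtain ⟨B, hB⟩ := id hDQ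
  have hcop : IsCoprime A B := by
    refine ⟨EuclideanDomain.gcdA P Q, EuclideanDomain.gcdB P Q, mul_left_cancel₀ hD0 ?_⟩
    linear_combination -hab - EuclideanDomain.gcdA P Q * hA - EuclideanDomain.gcdB P Q * hB
  have hdeg : ∀ {R S : Polynomial F}, R = D * S → R.natDegree ≤ e → D.natDegree ≤ e →
      D.natDegree + S.natDegree ≤ e := fun {R S} h1 h2 h3 => by
    by_cases hS : S = 0
    · simpa [hS] using h3
    · rwa [h1, Polynomial.natDegree_mul hD0 hS] at h2
  have hDe : D.natDegree ≤ e := by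
    rcases h with h | h
    · exact (Polynomial.natDegree_le_of_dvd hDP h).trans hP
    · exact (Polynomial.natDegree_le_of_dvd hDQ h).trans hQ
  refine ⟨D, A, B, hcop, hA, hB, ?_⟩
  rcases max_choice A.natDegree B.natDegree with hm | hm <;> rw [hm]
  · exact hdeg hA hP hDe
  · exact hdeg hB hQ hDe

theorem isInversionQuotient_thetaQuotient (h2 : (2 : K) ≠ 0) {t : Kˣ} (ht : 1 < ‖(t : K)‖) :
    IsInversionQuotient (thetaQuotient (t ^ (-2 : ℤ))) := by
  have hq : ‖((t ^ (-2 : ℤ) : Kˣ) : K)‖ < 1 := by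
    rw [Units.val_zpow_eq_zpow_val, norm_zpow]
    exact zpow_lt_one_of_neg₀ ht (by norm_num)
  refine ⟨isAnalyticToP1_thetaQuotient h2 hq, thetaQuotient_inv hq, fun f hf hinv => ?_⟩
  obtain ⟨e, g, h, a, b, hg, hh, -, -, hab, hfz⟩ := hf.exists_symmTheta h2 hinv
  rcases lt_or_ge e 0 with he | he
  · have := hab 1
    simp [hg.eq_zero_of_neg hq he, hh.eq_zero_of_neg hq he] at this
  obtain ⟨e, rfl⟩ := Int.eq_ofNat_of_zero_le he
  obtain ⟨P, hP, hgP⟩ := hg.exists_form h2 hq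
  obtain ⟨Q, hQ, hhQ⟩ := hh.exists_form h2 hq
  obtain ⟨D, A, B, hcop, rfl, rfl, hdeg⟩ := exists_isCoprime_factorization hP hQ (by
    by_contra! h0
    have := hab 1
    simp [hgP, hhQ, h0.1, h0.2, formEval] at this)
  refine ⟨A, B, hcop, fun R => ?_⟩
  set d := max A.natDegree B.natDegree with hd
  -- The common factor `D` is read as a form of degree `m = e - d`, possibly above its polynomial
  -- degree, to account for a common power of `Y`. It vanishes nowhere on `𝔾_m` because `g` and `h`
  -- have no common zero.
  obtain ⟨m, rfl⟩ := Nat.exists_eq_add_of_le (le_of_add_le_right hdeg)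
  induction R using QuotientGroup.induction_on with
  | H z =>
    have hg' := hgP z
    have hh' := hhQ z
    rw [add_comm, formEval_mul (by omega) (le_max_left _ _), ← hd] at hg'
    rw [add_comm, formEval_mul (by omega) (le_max_right _ _), ← hd] at hh'
    have hD : formEval m D (thetaEven (t ^ (-2 : ℤ)) z) (thetaOdd (t ^ (-2 : ℤ)) z) ≠ 0 := by
      intro h0
      have := hab z
      rw [hg', hh', h0] at this
      simp at this
    rw [hfz, thetaQuotient_mk hq, ratMap_projPoint _ _ (thetaEven_ne_zero_or h2 hq z), hg', hh',
      projPoint_mul hD]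

/-- All quotient maps differ from the one given by theta functions by a Möbius transformation. -/
theorem IsInversionQuotient.exists_ratMap (h2 : (2 : K) ≠ 0) {t : Kˣ} (ht : 1 < ‖(t : K)‖)
    {π : TateCurve (t ^ (-2 : ℤ)) → OnePoint K} (hπ : IsInversionQuotient π) :
    ∃ A B : Polynomial K, IsCoprime A B ∧ max A.natDegree B.natDegree = 1 ∧
      (∀ P, π P = ratMap A B (thetaQuotient (t ^ (-2 : ℤ)) P)) ∧
      ∀ P Q, π P = π Q → thetaQuotient (t ^ (-2 : ℤ)) P = thetaQuotient (t ^ (-2 : ℤ)) Q := by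
  have hq : ‖((t ^ (-2 : ℤ) : Kˣ) : K)‖ < 1 := by
    rw [Units.val_zpow_eq_zpow_val, norm_zpow]
    exact zpow_lt_one_of_neg₀ ht (by norm_num)
  have hθ := isInversionQuotient_thetaQuotient h2 ht
  obtain ⟨A, B, hAB, h1⟩ := hθ.2.2 π hπ.1 hπ.2.1
  obtain ⟨C, D, hCD, h3⟩ := hπ.2.2 _ hθ.1 hθ.2.1
  refine ⟨A, B, hAB, ?_, h1, fun P Q h => by rw [h3, h3, h]⟩
  refine max_natDegree_eq_one_of_leftInverse hAB hCD
    (infinite_thetaEven_div_thetaOdd h2 hq) ?_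
  rintro _ ⟨z, hz, rfl⟩
  have hz' : thetaQuotient (t ^ (-2 : ℤ)) (QuotientGroup.mk z) =
      ((thetaEven (t ^ (-2 : ℤ)) z / thetaOdd (t ^ (-2 : ℤ)) z : K) : OnePoint K) := by
    rw [thetaQuotient_mk hq, projPoint, if_neg hz]
  rw [← hz', ← h1, ← h3]

end Quotient

/-! ### Euler's product and the triple product identity. -/

section EulerProduct

variable {K : Type*} [NontriviallyNormedField K]

/-- The coefficients of the power series of `∏ (1 + s ^ (2 i + 1) z)`. -/
noncomputable def eulerCoeff (s : K) : ℕ → K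
  | 0 => 1
  | k + 1 => s ^ (2 * k + 1) / (1 - s ^ (2 * k + 2)) * eulerCoeff s k

/-- The power series of `∏ (1 + s ^ (2 i + 1) z)`. -/
noncomputable def eulerSeries (s z : K) : K := ∑' k : ℕ, eulerCoeff s k * z ^ k

variable [IsUltrametricDist K]

theorem norm_one_sub_of_norm_lt_one {L : Type*} [NormedField L] [IsUltrametricDist L] {x : L}
    (hx : ‖x‖ < 1) : ‖1 - x‖ = 1 := by
  have := IsUltrametricDist.norm_add_eq_max_of_norm_ne_norm (x := (1 : L)) (y := -x)
    (by rw [norm_neg, norm_one]; exact hx.ne')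
  rw [sub_eq_add_neg, this, norm_neg, norm_one, max_eq_left hx.le]

theorem norm_eulerCoeff {s : K} (hs : ‖s‖ < 1) (k : ℕ) : ‖eulerCoeff s k‖ = ‖s‖ ^ (k ^ 2) := by
  induction k with
  | zero => simp [eulerCoeff]
  | succ k ih =>
    have : ‖s ^ (2 * k + 2)‖ < 1 := by
      rw [norm_pow]; exact pow_lt_one₀ (norm_nonneg _) hs (by omega)
    rw [eulerCoeff, norm_mul, norm_div, norm_one_sub_of_norm_lt_one this, ih, div_one, norm_pow,
      ← pow_add]
    congr 1
    ring

theorem eulerCoeff_succ {s : K} (hs : ‖s‖ < 1) (k : ℕ) :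
    eulerCoeff s (k + 1) =
      s ^ (2 * (k + 1)) * eulerCoeff s (k + 1) + s * (s ^ (2 * k) * eulerCoeff s k) := by
  have : ‖s ^ (2 * k + 2)‖ < 1 := by
    rw [norm_pow]; exact pow_lt_one₀ (norm_nonneg _) hs (by omega)
  have h1 : 1 - s ^ (2 * k + 2) ≠ 0 := by
    rw [← norm_pos_iff, norm_one_sub_of_norm_lt_one this]; exact one_pos
  have h3 : eulerCoeff s (k + 1) * (1 - s ^ (2 * k + 2)) = s ^ (2 * k + 1) * eulerCoeff s k := by
    rw [eulerCoeff]; field_simp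
  linear_combination h3

variable [CompleteSpace K]

theorem hasSum_eulerSeries {s : Kˣ} (hs : ‖(s : K)‖ < 1) (z : K) :
    HasSum (fun k : ℕ => eulerCoeff (s : K) k * z ^ k) (eulerSeries s z) := by
  have hs0 : 0 < ‖(s : K)‖ := norm_pos_iff.2 s.ne_zero
  refine Summable.hasSum ?_
  by_cases hz : z = 0
  · subst hz
    exact summable_of_ne_finset_zero (s := {0}) fun k hk => by
      have : k ≠ 0 := by simpa using hk
      simp [this]
  · have := (hasSum_thetaSeries hs (Units.mk0 z hz)).summable.comp_injective
      (Nat.cast_injective (R := ℤ))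
    refine this.of_norm_le_of_ultrametric fun k => ?_
    simp only [Function.comp]
    rw [Units.val_mul, norm_mul, norm_mul, norm_eulerCoeff hs,
      show ((k : ℤ) ^ 2) = ((k ^ 2 : ℕ) : ℤ) by push_cast; rfl, zpow_natCast, zpow_natCast]
    simp

theorem isHolomorphicGm_eulerSeries {s : Kˣ} (hs : ‖(s : K)‖ < 1) :
    IsHolomorphicGm (fun z : Kˣ => eulerSeries (s : K) z) := by
  refine ⟨Function.extend (fun k : ℕ => (k : ℤ)) (eulerCoeff (s : K)) 0, fun z => ?_⟩
  have hinj : Function.Injective fun k : ℕ => (k : ℤ) := Nat.cast_injective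
  refine (hinj.hasSum_iff fun n hn => ?_).1 ((hasSum_eulerSeries hs z).congr_terms fun n => ?_)
  · rw [Function.extend_apply' _ _ _ hn]; simp
  · simp only [Function.comp, hinj.extend_apply]
    simp

/-- The recursion of the coefficients is this functional equation read off termwise. Iterating it
produces the finite products, with a remaining factor `eulerSeries s (s ^ (2n) * z)` that tends to
`1`. -/
theorem eulerSeries_eq_mul {s : Kˣ} (hs : ‖(s : K)‖ < 1) (z : K) :
    eulerSeries (s : K) z = (1 + s * z) * eulerSeries (s : K) (s ^ 2 * z) := by
  have h1 := hasSum_eulerSeries hs (s ^ 2 * z)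
  have h3 := (HasSum.zero_add (f := fun k : ℕ => eulerCoeff (s : K) k * z ^ k -
    eulerCoeff (s : K) k * ((s : K) ^ 2 * z) ^ k) ((h1.mul_left (s * z)).congr_terms fun k => by
      rw [mul_pow, mul_pow, ← pow_mul, ← pow_mul]
      linear_combination (-z ^ (k + 1)) * eulerCoeff_succ hs k))
  have h4 := h3.unique ((hasSum_eulerSeries hs z).sub h1)
  simp only [pow_zero, sub_self, zero_add] at h4
  linear_combination -h4

theorem norm_eulerSeries_sub_one_le {s : Kˣ} (hs : ‖(s : K)‖ < 1) {z : K} (hz : ‖z‖ ≤ 1) :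
    ‖eulerSeries (s : K) z - 1‖ ≤ ‖(s : K)‖ * ‖z‖ := by
  have h1 := (hasSum_nat_add_iff' 1).2 (hasSum_eulerSeries hs z)
  have h0 : eulerCoeff (s : K) 0 = 1 := rfl
  simp only [Finset.sum_range_one, pow_zero, mul_one, h0] at h1
  refine h1.norm_le_of_ultrametric (by positivity) fun k => ?_
  rw [norm_mul, norm_eulerCoeff hs, norm_pow, pow_succ ‖z‖]
  have e1 : ‖(s : K)‖ ^ ((k + 1) ^ 2) ≤ ‖(s : K)‖ :=
    pow_le_of_le_one (norm_nonneg _) hs.le (by positivity)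
  have e2 : ‖z‖ ^ k * ‖z‖ ≤ ‖z‖ :=
    mul_le_of_le_one_left (norm_nonneg _) (pow_le_one₀ (norm_nonneg _) hz)
  gcongr

theorem eulerSeries_ne_zero {s : Kˣ} (hs : ‖(s : K)‖ < 1) {z : K} (hz : ‖z‖ ≤ 1) :
    eulerSeries (s : K) z ≠ 0 := fun h0 => by
  have := norm_eulerSeries_sub_one_le hs hz
  rw [h0, zero_sub, norm_neg, norm_one] at this
  nlinarith [norm_nonneg z, norm_nonneg (s : K)]

theorem eulerSeries_eq_prod_mul {s : Kˣ} (hs : ‖(s : K)‖ < 1) (z : K) (n : ℕ) :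
    eulerSeries (s : K) z = (∏ i ∈ Finset.range n, (1 + (s : K) ^ (2 * i + 1) * z)) *
      eulerSeries (s : K) (s ^ (2 * n) * z) := by
  induction n with
  | zero => simp
  | succ n ih =>
    rw [ih, Finset.prod_range_succ, eulerSeries_eq_mul hs ((s : K) ^ (2 * n) * z), mul_assoc]
    congr 2
    · ring
    · congr 1; ring

theorem tendsto_prod_eulerSeries {s : Kˣ} (hs : ‖(s : K)‖ < 1) (z : K) :
    Tendsto (fun n : ℕ => ∏ i ∈ Finset.range n, (1 + (s : K) ^ (2 * i + 1) * z)) atTop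
      (𝓝 (eulerSeries (s : K) z)) := by
  have h0 : Tendsto (fun n : ℕ => (s : K) ^ (2 * n) * z) atTop (𝓝 0) := by
    have h1 : ‖(s : K) ^ 2‖ < 1 := by
      rw [norm_pow]; exact pow_lt_one₀ (norm_nonneg _) hs two_ne_zero
    have := (tendsto_pow_atTop_nhds_zero_of_norm_lt_one h1).mul_const z
    simpa [pow_mul] using this
  have hev : ∀ᶠ n : ℕ in atTop, ‖(s : K) ^ (2 * n) * z‖ ≤ 1 :=
    (h0.eventually (Metric.closedBall_mem_nhds (0 : K) one_pos)).mono fun _ hn =>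
      mem_closedBall_zero_iff.1 hn
  have h1 : Tendsto (fun n : ℕ => eulerSeries (s : K) (s ^ (2 * n) * z)) atTop (𝓝 1) := by
    rw [tendsto_iff_norm_sub_tendsto_zero]
    have h3 := (tendsto_zero_iff_norm_tendsto_zero.1 h0).const_mul ‖(s : K)‖
    rw [mul_zero] at h3
    exact squeeze_zero' (Eventually.of_forall fun _ => norm_nonneg _)
      (hev.mono fun n hn => norm_eulerSeries_sub_one_le hs hn) h3
  have h3 := (tendsto_const_nhds (x := eulerSeries (s : K) z)).div h1 one_ne_zero
  rw [div_one] at h3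
  refine h3.congr' (hev.mono fun n hn => ?_)
  rw [Pi.div_apply, eulerSeries_eq_prod_mul hs z n, mul_div_cancel_right₀]
  exact eulerSeries_ne_zero hs hn

/-- A form of the Jacobi triple product identity. -/
theorem exists_eulerSeries_mul_eq_thetaSeries {s : Kˣ} (hs : ‖(s : K)‖ < 1) :
    ∃ c : K, ∀ z : Kˣ, eulerSeries (s : K) z * eulerSeries (s : K) (z⁻¹ : Kˣ) =
      c * thetaSeries s z := by
  have hE := isHolomorphicGm_eulerSeries hs
  have hP : IsHolomorphicGm
      (fun z : Kˣ => eulerSeries (s : K) z * eulerSeries (s : K) (z⁻¹ : Kˣ)) := hE.mul hE.comp_inv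
  set P : Kˣ → K := fun z => eulerSeries (s : K) z * eulerSeries (s : K) (z⁻¹ : Kˣ) with hPdef
  have hlin : IsHolomorphicGm (fun z : Kˣ => 1 + (s : K) * z) := by
    have := (IsHolomorphicGm.const (K := K) 1).add
      (((IsHolomorphicGm.const (K := K) 1).zpow_mul 1).const_mul (s : K))
    simpa only [zpow_one, mul_one] using this
  -- The functional equations of the two factors give this relation multiplied by `1 + s z`;
  -- cancelling in the domain of holomorphic functions also covers the zero of that factor.
  have hfun : ∀ z : Kˣ, P (s ^ 2 * z) - ((s⁻¹ : Kˣ) : K) * (((z ^ (-1 : ℤ) : Kˣ) : K) * P z) = 0 := by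
    have hd := hlin.eq_zero_or_eq_zero_of_mul ((hP.comp_mul (s ^ 2)).sub
      ((hP.zpow_mul (-1)).const_mul ((s⁻¹ : Kˣ) : K))) fun z => by
        simp only [hPdef]
        have e1 := eulerSeries_eq_mul hs (z : K)
        have e2 := eulerSeries_eq_mul hs (((s ^ 2 * z)⁻¹ : Kˣ) : K)
        have e3 : (s : K) ^ 2 * (((s ^ 2 * z)⁻¹ : Kˣ) : K) = ((z⁻¹ : Kˣ) : K) := by
          push_cast; field_simp
        have e4 : 1 + (s : K) * (((s ^ 2 * z)⁻¹ : Kˣ) : K) =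
            ((s⁻¹ : Kˣ) : K) * ((z ^ (-1 : ℤ) : Kˣ) : K) * (1 + s * z) := by
          rw [zpow_neg_one]; push_cast; field_simp; ring
        rw [e3, e4] at e2
        rw [e2, e1]
        push_cast
        ring
    rcases hd with hd | hd
    · exfalso
      have h1 := congrFun hd 1
      simp only [Units.val_one, mul_one, Pi.zero_apply] at h1
      have h3 : (s : K) = -1 := by linear_combination h1
      rw [h3, norm_neg, norm_one] at hs
      exact hs.false
    · exact fun z => congrFun hd z
  obtain ⟨p, hp : IsLaurentSum p P⟩ := hP
  -- Comparing coefficients leaves one free constant `p 0` and gives `p k = p 0 * s ^ (k ^ 2)`. Its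
  -- value is not needed: it drops out of the ratio of the values at `1` and `-1`.
  have hrec : ∀ k : ℤ, p (k + 1) = ((s ^ (2 * k + 1) : Kˣ) : K) * p k := fun k => by
    have h1 := hp.comp_mul (s ^ 2)
    have h3 := ((hp.zpow_mul (-1)).const_mul ((s⁻¹ : Kˣ) : K))
    have h4 := h1.coeff_unique (b := fun n => ((s⁻¹ : Kˣ) : K) * p (n - -1)) fun z => by
      have := h3 z
      simp only at this ⊢
      rwa [sub_eq_zero.1 (hfun z)]
    have h5 := congrFun h4 k
    have h6 : (s : K) * ((s⁻¹ : Kˣ) : K) = 1 := by simp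
    rw [sub_neg_eq_add] at h5
    rw [zpow_add_one, zpow_mul, Units.val_mul]
    have h7 : (((s ^ (2 : ℤ)) ^ k : Kˣ) : K) = (((s ^ 2) ^ k : Kˣ) : K) := rfl
    rw [h7]
    linear_combination (-p (k + 1)) * h6 - (s : K) * h5
  have hcoeff : ∀ k : ℤ, p k = p 0 * ((s ^ (k ^ 2) : Kˣ) : K) := fun k => by
    induction k using Int.induction_on with
    | zero => simp
    | succ n ih =>
      rw [hrec, ih, mul_left_comm, ← Units.val_mul, ← zpow_add]
      congr 3
      ring
    | pred n ih =>
      have h1 := hrec (-n - 1)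
      rw [sub_add_cancel, ih] at h1
      have h3 : ((s ^ (2 * (-(n : ℤ) - 1) + 1) : Kˣ) : K) *
          ((s ^ (-(2 * (-(n : ℤ) - 1) + 1)) : Kˣ) : K) = 1 := by
        rw [← Units.val_mul, ← zpow_add]; simp
      have h4 : ((s ^ ((-(n : ℤ)) ^ 2) : Kˣ) : K) *
          ((s ^ (-(2 * (-(n : ℤ) - 1) + 1)) : Kˣ) : K) =
            ((s ^ ((-(n : ℤ) - 1) ^ 2) : Kˣ) : K) := by
        rw [← Units.val_mul, ← zpow_add]
        congr 2
        ring
      rw [← h4]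
      linear_combination (-p (-n - 1)) * h3 -
        ((s ^ (-(2 * (-(n : ℤ) - 1) + 1)) : Kˣ) : K) * h1
  refine ⟨p 0, fun z => ?_⟩
  refine (hp z).unique (((isLaurentSum_thetaSeries hs).const_mul (p 0) z).congr_terms fun n => ?_)
  rw [hcoeff n]

theorem thetaSeries_one_mul_eulerSeries {s : Kˣ} (hs : ‖(s : K)‖ < 1) :
    thetaSeries s 1 * eulerSeries (s : K) (-1) ^ 2 =
      thetaSeries s (-1) * eulerSeries (s : K) 1 ^ 2 := by
  obtain ⟨c, hc⟩ := exists_eulerSeries_mul_eq_thetaSeries hs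
  have h1 := hc 1
  have h3 := hc (-1)
  rw [inv_neg, inv_one] at h3
  rw [inv_one] at h1
  push_cast at h1 h3
  have hE := eulerSeries_ne_zero hs (z := 1) (by simp)
  have hc0 : c ≠ 0 := by
    rintro rfl
    rw [zero_mul] at h1
    exact mul_ne_zero hE hE h1
  refine mul_left_cancel₀ hc0 ?_
  linear_combination thetaSeries s 1 * c * h3 - thetaSeries s (-1) * c * h1

end EulerProduct

/-! ### Duplication of theta constants. -/

section ThetaSquares

variable {K : Type*} [NontriviallyNormedField K] [IsUltrametricDist K] [CompleteSpace K]

/-- The duplication formula for theta constants. -/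
theorem thetaSeries_sq {s : Kˣ} (hs : ‖(s : K)‖ < 1) {ε : Kˣ} (hε : ε ^ 2 = 1) :
    thetaSeries s ε ^ 2 = thetaSeries (s ^ 2) 1 ^ 2 +
      ε * s * thetaSeries (s ^ 2) (s ^ 2) ^ 2 := by
  have hq : ‖((s ^ 2 : Kˣ) : K)‖ < 1 := by
    rw [Units.val_pow_eq_pow_val, norm_pow]; exact pow_lt_one₀ (norm_nonneg _) hs two_ne_zero
  have hε2 : ∀ k : ℤ, ε ^ (2 * k) = 1 := fun k => by
    rw [zpow_mul, show ε ^ (2 : ℤ) = ε ^ 2 from zpow_ofNat ε 2, hε, one_zpow]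
  have hs2 : ∀ k : ℤ, (s ^ 2) ^ k = s ^ (2 * k) := fun k => by
    rw [zpow_mul, zpow_ofNat]
  have htot := (hasSum_thetaSeries hs ε).mul_of_nonarchimedean (hasSum_thetaSeries hs ε)
  have h1 := ((hasSum_thetaSeries hq 1).mul_of_nonarchimedean (hasSum_thetaSeries hq 1))
  have h3 := ((hasSum_thetaSeries hq (s ^ 2)).mul_of_nonarchimedean
    (hasSum_thetaSeries hq (s ^ 2))).mul_left ((ε * s : Kˣ) : K)
  -- The index pairs `(m, n)` of the square are split by the parity of `m + n`. On these two
  -- parametrizations `m ^ 2 + n ^ 2` becomes `2 a² + 2 b²` and `2 (a² + a) + 2 (b² + b) + 1`, so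
  -- each part is a square of a theta constant for `s ^ 2`.
  set e₁ : ℤ × ℤ → ℤ × ℤ := fun p => (p.1 + p.2, p.1 - p.2) with he₁
  set e₂ : ℤ × ℤ → ℤ × ℤ := fun p => (p.1 + p.2 + 1, p.1 - p.2) with he₂
  have hi₁ : Function.Injective e₁ := fun p r h => by
    simp only [he₁, Prod.mk.injEq] at h
    ext <;> omega
  have hi₂ : Function.Injective e₂ := fun p r h => by
    simp only [he₂, Prod.mk.injEq] at h
    ext <;> omega
  have hcompl : IsCompl (Set.range e₁) (Set.range e₂) := by
    constructor
    · rw [Set.disjoint_left]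
      rintro _ ⟨p, rfl⟩ ⟨r, hr⟩
      simp only [he₁, he₂, Prod.mk.injEq] at hr
      omega
    · rw [codisjoint_iff_le_sup]
      rintro ⟨m, n⟩ -
      rcases Int.even_or_odd (m + n) with ⟨k, hk⟩ | ⟨k, hk⟩
      · exact Or.inl ⟨(k, m - k), by simp only [he₁, Prod.mk.injEq]; omega⟩
      · exact Or.inr ⟨(k, m - k - 1), by simp only [he₂, Prod.mk.injEq]; omega⟩
  set F : ℤ × ℤ → K := fun x =>
    ((s ^ (x.1 ^ 2) * ε ^ x.1 : Kˣ) : K) * ((s ^ (x.2 ^ 2) * ε ^ x.2 : Kˣ) : K) with hF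
  have hr₁ : HasSum (F ∘ e₁) (thetaSeries (s ^ 2) 1 * thetaSeries (s ^ 2) 1) := by
    refine h1.congr_terms fun p => ?_
    simp only [Function.comp, hF, he₁]
    rw [← Units.val_mul, ← Units.val_mul]
    congr 1
    simp only [one_zpow, mul_one, hs2]
    rw [mul_mul_mul_comm (s ^ _), ← zpow_add, ← zpow_add, ← zpow_add,
      show p.1 + p.2 + (p.1 - p.2) = 2 * p.1 by ring, hε2, mul_one]
    congr 1
    ring
  have hr₂ : HasSum (F ∘ e₂) (((ε * s : Kˣ) : K) *
      (thetaSeries (s ^ 2) (s ^ 2) * thetaSeries (s ^ 2) (s ^ 2))) := by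
    refine h3.congr_terms fun p => ?_
    simp only [Function.comp, hF, he₂]
    rw [← Units.val_mul, ← Units.val_mul, ← Units.val_mul]
    congr 1
    simp only [hs2]
    rw [mul_mul_mul_comm (s ^ ((p.1 + p.2 + 1) ^ 2)), ← zpow_add, ← zpow_add, ← zpow_add,
      ← zpow_add, ← zpow_add, show p.1 + p.2 + 1 + (p.1 - p.2) = 2 * p.1 + 1 by ring, zpow_add_one,
      hε2, one_mul, mul_assoc, ← zpow_one_add, mul_comm ε]
    congr 2
    ring
  have hsplit : HasSum F _ :=
    (hi₁.hasSum_range_iff.2 hr₁).add_isCompl hcompl (hi₂.hasSum_range_iff.2 hr₂)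
  have htot' : HasSum F _ := htot
  have h := htot'.unique hsplit
  rw [Units.val_mul] at h
  linear_combination h

end ThetaSquares

/-! ### Uniform estimates for the partial products, valid over incomplete fields too. -/

section InfiniteProduct

variable {L : Type*} [NormedField L] [IsUltrametricDist L]

/-- The partial products of `λ ^ (1 / 8)` in the coordinate `w = 1 / t`. -/
noncomputable def lambdaPartial {L : Type*} [Field L] (n : ℕ) (w : L) : L :=
  ∏ i ∈ Finset.range n, (1 + w ^ (2 * i + 1)) / (1 - w ^ (2 * i + 1))

theorem one_sub_pow_ne_zero {w : L} (hw : ‖w‖ < 1) (i : ℕ) : 1 - w ^ (2 * i + 1) ≠ 0 := by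
  have : ‖w ^ (2 * i + 1)‖ < 1 := by
    rw [norm_pow]; exact pow_lt_one₀ (norm_nonneg _) hw (by omega)
  rw [← norm_pos_iff, norm_one_sub_of_norm_lt_one this]
  exact one_pos

theorem norm_lambdaPartial_factor_sub_one_le {w : L} (hw : ‖w‖ < 1) (i : ℕ) :
    ‖(1 + w ^ (2 * i + 1)) / (1 - w ^ (2 * i + 1)) - 1‖ ≤ ‖w‖ ^ i := by
  have h1 : ‖w ^ (2 * i + 1)‖ < 1 := by
    rw [norm_pow]; exact pow_lt_one₀ (norm_nonneg _) hw (by omega)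
  have h2 := one_sub_pow_ne_zero hw i
  rw [show (1 + w ^ (2 * i + 1)) / (1 - w ^ (2 * i + 1)) - 1 =
    2 * w ^ (2 * i + 1) / (1 - w ^ (2 * i + 1)) by field_simp; ring, norm_div,
    norm_one_sub_of_norm_lt_one h1, div_one, norm_mul, norm_pow]
  have h3 : ‖(2 : L)‖ ≤ 1 := by exact_mod_cast IsUltrametricDist.norm_natCast_le_one L 2
  calc ‖(2 : L)‖ * ‖w‖ ^ (2 * i + 1) ≤ 1 * ‖w‖ ^ i := by
        gcongr ?_ * ?_
        exact pow_le_pow_of_le_one (norm_nonneg _) hw.le (by omega)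
    _ = _ := one_mul _

theorem norm_lambdaPartial_le {w : L} (hw : ‖w‖ < 1) (n : ℕ) : ‖lambdaPartial n w‖ ≤ 1 := by
  rw [lambdaPartial, norm_prod]
  refine Finset.prod_le_one (fun _ _ => norm_nonneg _) fun i _ => ?_
  have h1 := norm_lambdaPartial_factor_sub_one_le hw i
  have h2 := IsUltrametricDist.norm_add_le_max
    ((1 + w ^ (2 * i + 1)) / (1 - w ^ (2 * i + 1)) - 1) 1
  rw [sub_add_cancel, norm_one] at h2
  exact h2.trans (max_le (h1.trans (pow_le_one₀ (norm_nonneg _) hw.le)) le_rfl)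

theorem norm_lambdaPartial_sub_le {w : L} (hw : ‖w‖ < 1) {m n : ℕ} (h : n ≤ m) :
    ‖lambdaPartial m w - lambdaPartial n w‖ ≤ ‖w‖ ^ n := by
  induction m, h using Nat.le_induction with
  | base => simp
  | succ m hm ih =>
    have h1 : ‖lambdaPartial (m + 1) w - lambdaPartial m w‖ ≤ ‖w‖ ^ n := by
      rw [lambdaPartial, Finset.prod_range_succ, ← lambdaPartial, ← mul_sub_one, norm_mul]
      refine (mul_le_of_le_one_left (norm_nonneg _) (norm_lambdaPartial_le hw m)).trans ?_
      exact (norm_lambdaPartial_factor_sub_one_le hw m).trans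
        (pow_le_pow_of_le_one (norm_nonneg _) hw.le hm)
    have h2 := IsUltrametricDist.norm_add_le_max
      (lambdaPartial (m + 1) w - lambdaPartial m w) (lambdaPartial m w - lambdaPartial n w)
    rw [sub_add_sub_cancel] at h2
    exact h2.trans (max_le h1 ih)

theorem norm_pow_sub_pow_le {x y : L} (hx : ‖x‖ ≤ 1) (hy : ‖y‖ ≤ 1) (k : ℕ) :
    ‖x ^ k - y ^ k‖ ≤ ‖x - y‖ := by
  induction k with
  | zero => simp
  | succ k ih =>
    have h := IsUltrametricDist.norm_add_le_max (x ^ k * (x - y)) ((x ^ k - y ^ k) * y)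
    rw [show x ^ k * (x - y) + (x ^ k - y ^ k) * y = x ^ (k + 1) - y ^ (k + 1) by ring, norm_mul,
      norm_mul, norm_pow] at h
    refine h.trans (max_le ?_ ?_)
    · exact mul_le_of_le_one_left (norm_nonneg _) (pow_le_one₀ (norm_nonneg _) hx)
    · exact (mul_le_of_le_one_right (norm_nonneg _) hy).trans ih

theorem norm_lambdaPartial_pow_sub_le {w : L} {r : ℝ} (hr : r < 1) (hw : ‖w‖ ≤ r) {N m n : ℕ}
    (hm : N ≤ m) (hn : N ≤ n) :
    ‖lambdaPartial m w ^ 8 - lambdaPartial n w ^ 8‖ ≤ r ^ N := by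
  wlog hmn : n ≤ m generalizing m n
  · rw [norm_sub_rev]
    exact this hn hm (le_of_not_ge hmn)
  have hw1 := hw.trans_lt hr
  refine (norm_pow_sub_pow_le (norm_lambdaPartial_le hw1 m) (norm_lambdaPartial_le hw1 n) 8).trans ?_
  refine (norm_lambdaPartial_sub_le hw1 hmn).trans ?_
  exact (pow_le_pow_of_le_one (norm_nonneg _) hw1.le hn).trans
    (pow_le_pow_left₀ (norm_nonneg _) hw N)

end InfiniteProduct

/-! ### Convergence and holomorphy of `λ`. -/

section Lambda

variable {K : Type*} [NontriviallyNormedField K]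

theorem lambdaFactor_inv {w : K} (hw : w ≠ 0) (i : ℕ) :
    lambdaFactor w⁻¹ i = (1 + w ^ (2 * i + 1)) / (1 - w ^ (2 * i + 1)) := by
  have h : w ^ (2 * i + 1) ≠ 0 := pow_ne_zero _ hw
  rw [lambdaFactor, ← mul_div_mul_left _ _ h, inv_pow, mul_add, mul_sub, mul_inv_cancel₀ h, mul_one]

variable [IsUltrametricDist K] [CompleteSpace K]

theorem multipliable_lambdaFactor {t : K} (ht : 1 < ‖t‖) : Multipliable (lambdaFactor t) := by
  have ht0 : t ≠ 0 := norm_pos_iff.1 (one_pos.trans ht)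
  have hw : ‖t⁻¹‖ < 1 := by rw [norm_inv]; exact inv_lt_one_of_one_lt₀ ht
  have hs : Summable fun i => ‖lambdaFactor t i - 1‖ := by
    refine Summable.of_nonneg_of_le (fun _ => norm_nonneg _) (fun i => ?_)
      (summable_geometric_of_lt_one (norm_nonneg _) hw)
    have := norm_lambdaPartial_factor_sub_one_le hw i
    rwa [← lambdaFactor_inv (inv_ne_zero ht0), inv_inv] at this
  simpa using multipliable_one_add_of_summable hs

theorem tendsto_lambdaPartial {w : K} (hw : ‖w‖ < 1) (hw0 : w ≠ 0) :
    Tendsto (fun n => lambdaPartial n w) atTop (𝓝 (∏' i, lambdaFactor w⁻¹ i)) := by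
  have ht : 1 < ‖w⁻¹‖ := by
    rw [norm_inv]; exact (one_lt_inv₀ (norm_pos_iff.2 hw0)).2 hw
  have := (multipliable_lambdaFactor ht).hasProd.tendsto_prod_nat
  simpa only [lambdaFactor_inv hw0, lambdaPartial] using this

theorem tprod_lambdaFactor {s : Kˣ} (hs : ‖(s : K)‖ < 1) :
    ∏' i, lambdaFactor (s : K)⁻¹ i = eulerSeries (s : K) 1 / eulerSeries (s : K) (-1) := by
  refine tendsto_nhds_unique (tendsto_lambdaPartial hs s.ne_zero) ?_
  have := (tendsto_prod_eulerSeries hs 1).div (tendsto_prod_eulerSeries hs (-1))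
    (eulerSeries_ne_zero hs (by simp))
  refine this.congr fun n => ?_
  rw [Pi.div_apply, lambdaPartial, Finset.prod_div_distrib]
  simp only [mul_one, mul_neg, ← sub_eq_add_neg]

/-- `λ` is holomorphic on the open disk around `∞`. -/
theorem isHolomorphicDiskAtInfty_tateLambda :
    IsHolomorphicDiskAtInfty (tateLambda : OnePoint K → K) := by
  intro r hr0 hr1
  have heval : ∀ {F : Type _} [Field F] [Algebra K F] (n : ℕ) (w : F),
      Polynomial.aeval w ((∏ i ∈ Finset.range n,
        (1 + (Polynomial.X : Polynomial K) ^ (2 * i + 1))) ^ 8) /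
      Polynomial.aeval w ((∏ i ∈ Finset.range n,
        (1 - (Polynomial.X : Polynomial K) ^ (2 * i + 1))) ^ 8) = lambdaPartial n w ^ 8 := by
    intro F _ _ n w
    simp only [map_pow, map_prod, map_add, map_sub, map_one, Polynomial.aeval_X, lambdaPartial,
      Finset.prod_div_distrib, div_pow]
  refine ⟨fun n => (∏ i ∈ Finset.range n, (1 + Polynomial.X ^ (2 * i + 1))) ^ 8,
    fun n => (∏ i ∈ Finset.range n, (1 - Polynomial.X ^ (2 * i + 1))) ^ 8, ?_, ?_, ?_⟩
  · intro n w hw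
    -- The spectral norm makes the algebraic closure an ultrametric normed field, to which the
    -- estimates for the partial products apply; they need no completeness.
    let _ : NormedField (AlgebraicClosure K) := spectralNorm.normedField K (AlgebraicClosure K)
    have _ : IsUltrametricDist (AlgebraicClosure K) :=
      IsUltrametricDist.isUltrametricDist_of_isNonarchimedean_norm isNonarchimedean_spectralNorm
    have hw' : ‖w‖ < 1 := lt_of_le_of_lt hw hr1
    simp only [map_pow, map_prod, map_sub, map_one, Polynomial.aeval_X]
    exact pow_ne_zero _ (Finset.prod_ne_zero_iff.2 fun i _ => one_sub_pow_ne_zero hw' i)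
  · intro ε hε
    obtain ⟨N, hN⟩ := exists_pow_lt_of_lt_one hε hr1
    refine ⟨N, fun m n hm hn w hw => ?_⟩
    rw [heval, heval]
    let _ : NormedField (AlgebraicClosure K) := spectralNorm.normedField K (AlgebraicClosure K)
    have _ : IsUltrametricDist (AlgebraicClosure K) :=
      IsUltrametricDist.isUltrametricDist_of_isNonarchimedean_norm isNonarchimedean_spectralNorm
    have hw' : ‖w‖ ≤ r := hw
    exact (norm_lambdaPartial_pow_sub_le hr1 hw' hm hn).trans hN.le
  · intro w hw
    have hev : ∀ n, Polynomial.eval w ((∏ i ∈ Finset.range n,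
        (1 + (Polynomial.X : Polynomial K) ^ (2 * i + 1))) ^ 8) /
        Polynomial.eval w ((∏ i ∈ Finset.range n,
        (1 - (Polynomial.X : Polynomial K) ^ (2 * i + 1))) ^ 8) = lambdaPartial n w ^ 8 :=
      fun n => by rw [← heval n w, Polynomial.coe_aeval_eq_eval]
    simp only [hev]
    by_cases hw0 : w = 0
    · subst hw0
      have h1 : tateLambda (atInv (0 : K)) = 1 := by
        simp only [atInv, projPoint, if_true]
        rfl
      rw [h1]
      simp [lambdaPartial]
    · have h1 : tateLambda (atInv w) = (∏' i, lambdaFactor w⁻¹ i) ^ 8 := by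
        simp only [atInv, projPoint, hw0, if_false, one_div]
        rfl
      rw [h1]
      exact (tendsto_lambdaPartial (hw.trans_lt hr1) hw0).pow 8

end Lambda

/-! ### The four branch points and their cross ratio. -/

section BranchPoints

variable {K : Type*} [NontriviallyNormedField K]

theorem norm_zpow_neg_two_lt_one {t : Kˣ} (ht : 1 < ‖(t : K)‖) :
    ‖((t ^ (-2 : ℤ) : Kˣ) : K)‖ < 1 := by
  rw [Units.val_zpow_eq_zpow_val, norm_zpow]
  exact zpow_lt_one_of_neg₀ ht (by norm_num)

theorem setOf_sq_eq_one_tateCurve (t : Kˣ) : {P : TateCurve (t ^ (-2 : ℤ)) | P ^ 2 = 1} =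
    {QuotientGroup.mk 1, QuotientGroup.mk (-1), QuotientGroup.mk t, QuotientGroup.mk (-t)} := by
  have hmk : ∀ (a : Kˣ) (k : ℤ), (QuotientGroup.mk (a * (t ^ (-2 : ℤ)) ^ k) :
      TateCurve (t ^ (-2 : ℤ))) = QuotientGroup.mk a := fun a k => by
    rw [eq_comm, QuotientGroup.eq]
    exact ⟨k, by simp⟩
  ext P
  induction P using QuotientGroup.induction_on with
  | H z =>
    simp only [Set.mem_ofPred_eq, Set.mem_insert_iff, Set.mem_singleton_iff]
    constructor
    · intro h
      rw [← QuotientGroup.mk_pow, QuotientGroup.eq_one_iff] at h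
      obtain ⟨k, hk : (t ^ (-2 : ℤ)) ^ k = z ^ 2⟩ := h
      -- From `z ^ 2 = q ^ k = t ^ (-2k)` one gets `z = ± t ^ (-k)`; the parity of `k` decides
      -- between the classes of `±1` and `±t`.
      have hsq : (z * t ^ k) ^ 2 = 1 := by
        rw [mul_pow, ← hk, ← zpow_natCast (t ^ k), ← zpow_mul, ← zpow_mul, ← zpow_add]
        simp [mul_comm]
      have hz : ∀ ε : Kˣ, z * t ^ k = ε → z = ε * t ^ (-k) := fun ε h => by
        rw [← h, mul_assoc, ← zpow_add]; simp
      have hsq' : z * t ^ k = 1 ∨ z * t ^ k = -1 := by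
        have : ((z * t ^ k : Kˣ) : K) ^ 2 = 1 := by
          rw [← Units.val_pow_eq_pow_val, hsq]; rfl
        rcases mul_self_eq_one_iff.1 ((sq _).symm.trans this) with h | h
        · exact Or.inl (Units.ext h)
        · exact Or.inr (Units.ext h)
      rcases Int.even_or_odd' k with ⟨m, rfl | rfl⟩
      · have e : t ^ (-(2 * m)) = (t ^ (-2 : ℤ)) ^ m := by rw [← zpow_mul]; congr 1; ring
        rcases hsq' with h | h
        · left; rw [hz _ h, e, hmk]
        · right; left; rw [hz _ h, e, hmk]
      · have e : t ^ (-(2 * m + 1)) = t * (t ^ (-2 : ℤ)) ^ (m + 1) := by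
          rw [← zpow_mul, ← zpow_one_add]; congr 1; ring
        rcases hsq' with h | h
        · right; right; left; rw [hz _ h, e, one_mul, hmk]
        · right; right; right; rw [hz _ h, e, ← mul_assoc, hmk, neg_one_mul]
    · have h1 : (QuotientGroup.mk 1 : TateCurve (t ^ (-2 : ℤ))) = 1 := rfl
      have ht : (QuotientGroup.mk (t ^ 2) : TateCurve (t ^ (-2 : ℤ))) = 1 := by
        rw [QuotientGroup.eq_one_iff]
        exact ⟨-1, by simp [zpow_neg]⟩
      rintro (h | h | h | h) <;> rw [h, ← QuotientGroup.mk_pow]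
      · simp
      · simp
      · exact ht
      · rw [neg_sq]; exact ht

variable [IsUltrametricDist K] [CompleteSpace K]

/-- The theta functions at the branch points in terms of the theta constants. -/
theorem theta_branch_values {t : Kˣ} (ht : 1 < ‖(t : K)‖) :
    thetaEven (t ^ (-2 : ℤ)) t = thetaOdd (t ^ (-2 : ℤ)) 1 ∧
      thetaOdd (t ^ (-2 : ℤ)) t = t * thetaEven (t ^ (-2 : ℤ)) 1 := by
  have hq := norm_zpow_neg_two_lt_one ht
  have e : (t ^ (-2 : ℤ)) * t ^ 2 = 1 := by
    rw [← zpow_natCast, ← zpow_add]; simp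
  constructor
  · unfold thetaEven thetaOdd
    rw [one_pow, mul_one, Units.val_one, one_mul, ← thetaSeries_inv hq (t ^ 2)]
    congr 1
  · unfold thetaEven thetaOdd
    rw [e, one_pow]

theorem theta_square_relations {t : Kˣ} (ht : 1 < ‖(t : K)‖) :
    (t : K) * thetaSeries t⁻¹ 1 ^ 2 =
        t * thetaEven (t ^ (-2 : ℤ)) 1 ^ 2 + thetaOdd (t ^ (-2 : ℤ)) 1 ^ 2 ∧
      (t : K) * thetaSeries t⁻¹ (-1) ^ 2 =
        t * thetaEven (t ^ (-2 : ℤ)) 1 ^ 2 - thetaOdd (t ^ (-2 : ℤ)) 1 ^ 2 := by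
  have hs : ‖((t⁻¹ : Kˣ) : K)‖ < 1 := by
    rw [Units.val_inv_eq_inv_val, norm_inv]; exact inv_lt_one_of_one_lt₀ ht
  have hst : (t : K) * ((t⁻¹ : Kˣ) : K) = 1 := by simp
  have hq : (t⁻¹) ^ 2 = t ^ (-2 : ℤ) := by
    rw [← zpow_natCast, inv_zpow']; rfl
  have h1 := thetaSeries_sq hs (ε := 1) (by simp)
  have h2 := thetaSeries_sq hs (ε := -1) (by simp)
  rw [hq] at h1 h2
  push_cast at h1 h2
  unfold thetaEven thetaOdd
  simp only [one_pow, mul_one, Units.val_one, one_mul]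
  push_cast at hst
  constructor
  · linear_combination (t : K) * h1 + thetaSeries (t ^ (-2 : ℤ)) (t ^ (-2 : ℤ)) ^ 2 * hst
  · linear_combination (t : K) * h2 - thetaSeries (t ^ (-2 : ℤ)) (t ^ (-2 : ℤ)) ^ 2 * hst

theorem thetaSeries_one_neg_one_ne_zero {s : Kˣ} (hs : ‖(s : K)‖ < 1) :
    thetaSeries s 1 ≠ 0 ∧ thetaSeries s (-1) ≠ 0 := by
  have h1 : thetaSeries s 1 ≠ 0 := by
    rw [← norm_pos_iff, norm_thetaSeries_one hs]; exact one_pos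
  refine ⟨h1, fun h0 => ?_⟩
  have := thetaSeries_one_mul_eulerSeries hs
  rw [h0, zero_mul] at this
  exact mul_ne_zero h1 (pow_ne_zero 2 (eulerSeries_ne_zero hs (by simp))) this

theorem thetaQuotient_branch_points {t : Kˣ} (ht : 1 < ‖(t : K)‖) :
    thetaQuotient (t ^ (-2 : ℤ)) (QuotientGroup.mk 1) =
        projPoint (thetaEven (t ^ (-2 : ℤ)) 1) (thetaOdd (t ^ (-2 : ℤ)) 1) ∧
      thetaQuotient (t ^ (-2 : ℤ)) (QuotientGroup.mk (-1)) =
        projPoint (thetaEven (t ^ (-2 : ℤ)) 1) (-thetaOdd (t ^ (-2 : ℤ)) 1) ∧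
      thetaQuotient (t ^ (-2 : ℤ)) (QuotientGroup.mk t) =
        projPoint (thetaOdd (t ^ (-2 : ℤ)) 1) (t * thetaEven (t ^ (-2 : ℤ)) 1) ∧
      thetaQuotient (t ^ (-2 : ℤ)) (QuotientGroup.mk (-t)) =
        projPoint (thetaOdd (t ^ (-2 : ℤ)) 1) (-(t * thetaEven (t ^ (-2 : ℤ)) 1)) := by
  have hq := norm_zpow_neg_two_lt_one ht
  obtain ⟨h1, h2⟩ := theta_branch_values ht
  refine ⟨?_, ?_, ?_, ?_⟩ <;> rw [thetaQuotient_mk hq]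
  · rw [thetaEven_neg, thetaOdd_neg]
  · rw [h1, h2]
  · rw [thetaEven_neg, thetaOdd_neg, h1, h2]

/-- In homogeneous coordinates each coincidence would force the vanishing of `2 X Y`, `2 t X Y` or
`t X² ± Y²` at `z = 1`. The last two are `t` times squares of nonzero theta constants. -/
theorem thetaQuotient_pairwise_ne (h2 : (2 : K) ≠ 0) {t : Kˣ} (ht : 1 < ‖(t : K)‖) :
    let π : Kˣ → OnePoint K := fun z => thetaQuotient (t ^ (-2 : ℤ)) (QuotientGroup.mk z)
    π 1 ≠ π (-1) ∧ π 1 ≠ π t ∧ π 1 ≠ π (-t) ∧ π (-1) ≠ π t ∧ π (-1) ≠ π (-t) ∧ π t ≠ π (-t) := by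
  have hq := norm_zpow_neg_two_lt_one ht
  have hs : ‖((t⁻¹ : Kˣ) : K)‖ < 1 := by
    rw [Units.val_inv_eq_inv_val, norm_inv]; exact inv_lt_one_of_one_lt₀ ht
  obtain ⟨e1, e2, e3, e4⟩ := thetaQuotient_branch_points ht
  obtain ⟨r1, r2⟩ := theta_square_relations ht
  have hX := thetaEven_one_ne_zero hq
  have hY := thetaOdd_one_ne_zero h2 hq
  have ht0 : (t : K) ≠ 0 := t.ne_zero
  have hp : (t : K) * thetaEven (t ^ (-2 : ℤ)) 1 ^ 2 + thetaOdd (t ^ (-2 : ℤ)) 1 ^ 2 ≠ 0 := by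
    rw [← r1]; exact mul_ne_zero ht0 (pow_ne_zero 2 (thetaSeries_one_neg_one_ne_zero hs).1)
  have hm : (t : K) * thetaEven (t ^ (-2 : ℤ)) 1 ^ 2 - thetaOdd (t ^ (-2 : ℤ)) 1 ^ 2 ≠ 0 := by
    rw [← r2]; exact mul_ne_zero ht0 (pow_ne_zero 2 (thetaSeries_one_neg_one_ne_zero hs).2)
  intro π
  simp only [π, e1, e2, e3, e4]
  generalize thetaEven (t ^ (-2 : ℤ)) 1 = X at *
  generalize thetaOdd (t ^ (-2 : ℤ)) 1 = Y at *
  refine ⟨?_, ?_, ?_, ?_, ?_, ?_⟩ <;>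
    rw [Ne, projPoint_eq_iff (by first | exact Or.inl hX | exact Or.inl hY)
      (by first | exact Or.inl hX | exact Or.inl hY)] <;> intro h
  · exact mul_ne_zero h2 (mul_ne_zero hX hY) (by linear_combination -h)
  · exact hm (by linear_combination h)
  · exact hp (by linear_combination -h)
  · exact hp (by linear_combination h)
  · exact hm (by linear_combination -h)
  · exact mul_ne_zero h2 (mul_ne_zero ht0 (mul_ne_zero hX hY)) (by linear_combination -h)

theorem crossRatio_thetaQuotient (h2 : (2 : K) ≠ 0) {t : Kˣ} (ht : 1 < ‖(t : K)‖) :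
    crossRatio (thetaQuotient (t ^ (-2 : ℤ)) (QuotientGroup.mk (-t)))
      (thetaQuotient (t ^ (-2 : ℤ)) (QuotientGroup.mk t))
      (thetaQuotient (t ^ (-2 : ℤ)) (QuotientGroup.mk 1))
      (thetaQuotient (t ^ (-2 : ℤ)) (QuotientGroup.mk (-1))) =
        tateLambda ((t : K) : OnePoint K) := by
  have hq := norm_zpow_neg_two_lt_one ht
  have hs : ‖((t⁻¹ : Kˣ) : K)‖ < 1 := by
    rw [Units.val_inv_eq_inv_val, norm_inv]; exact inv_lt_one_of_one_lt₀ ht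
  obtain ⟨e1, e2, e3, e4⟩ := thetaQuotient_branch_points ht
  obtain ⟨r1, r2⟩ := theta_square_relations ht
  have hX := thetaEven_one_ne_zero hq
  have hY := thetaOdd_one_ne_zero h2 hq
  have ht0 : (t : K) ≠ 0 := t.ne_zero
  have hθ := thetaSeries_one_mul_eulerSeries hs
  have hθm := (thetaSeries_one_neg_one_ne_zero hs).2
  have hE := eulerSeries_ne_zero hs (z := -1) (by simp)
  have hval : tateLambda ((t : K) : OnePoint K) =
      (eulerSeries ((t⁻¹ : Kˣ) : K) 1 / eulerSeries ((t⁻¹ : Kˣ) : K) (-1)) ^ 8 := by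
    rw [← tprod_lambdaFactor hs, Units.val_inv_eq_inv_val, inv_inv]
    rfl
  rw [e1, e2, e3, e4, crossRatio_projPoint (Or.inl hY) (Or.inl hY) (Or.inl hX) (Or.inl hX), hval]
  have hratio : thetaSeries t⁻¹ 1 / thetaSeries t⁻¹ (-1) =
      (eulerSeries ((t⁻¹ : Kˣ) : K) 1 / eulerSeries ((t⁻¹ : Kˣ) : K) (-1)) ^ 2 := by
    rw [div_pow, div_eq_div_iff hθm (pow_ne_zero 2 hE), hθ]
    ring
  rw [show (8 : ℕ) = 2 * 4 from rfl, pow_mul, ← hratio, div_pow]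
  generalize thetaEven (t ^ (-2 : ℤ)) 1 = X at *
  generalize thetaOdd (t ^ (-2 : ℤ)) 1 = Y at *
  have hA : (Y * Y - X * -(t * X)) * (Y * -Y - X * (t * X)) =
      -(t : K) ^ 2 * thetaSeries t⁻¹ 1 ^ 4 := by
    linear_combination (t * thetaSeries t⁻¹ 1 ^ 2 + (t * X ^ 2 + Y ^ 2)) * r1
  have hB : (Y * -Y - X * -(t * X)) * (Y * Y - X * (t * X)) =
      -(t : K) ^ 2 * thetaSeries t⁻¹ (-1) ^ 4 := by
    linear_combination (t * thetaSeries t⁻¹ (-1) ^ 2 + (t * X ^ 2 - Y ^ 2)) * r2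
  rw [hA, hB, mul_div_mul_left _ _ (neg_ne_zero.2 (pow_ne_zero 2 ht0))]

end BranchPoints

theorem proposition2p1 {K : Type*} [NontriviallyNormedField K] [IsUltrametricDist K]
    [CompleteSpace K] (h2 : (2 : K) ≠ 0) :
    (∀ t : Kˣ, 1 < ‖(t : K)‖ →
      -- the points of `E_q` killed by two are the four classes of `1`, `-1`, `t`, `-t`
      ({P : TateCurve (t ^ (-2 : ℤ)) | P ^ 2 = 1} =
          {QuotientGroup.mk 1, QuotientGroup.mk (-1), QuotientGroup.mk t, QuotientGroup.mk (-t)} ∧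
        {P : TateCurve (t ^ (-2 : ℤ)) | P ^ 2 = 1}.ncard = 4) ∧
      -- the quotient of `E_q` by inversion is `ℙ¹`
      (∃ π : TateCurve (t ^ (-2 : ℤ)) → OnePoint K, IsInversionQuotient π) ∧
      -- the infinite product converges
      Multipliable (lambdaFactor (t : K)) ∧
      -- the cross ratio of the four branch points
      ∀ π : TateCurve (t ^ (-2 : ℤ)) → OnePoint K, IsInversionQuotient π →
        Set.InjOn π {P : TateCurve (t ^ (-2 : ℤ)) | P ^ 2 = 1} ∧
        crossRatio (π (QuotientGroup.mk (-t))) (π (QuotientGroup.mk t))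
            (π (QuotientGroup.mk 1)) (π (QuotientGroup.mk (-1))) =
          tateLambda ((t : K) : OnePoint K)) ∧
    IsHolomorphicDiskAtInfty (tateLambda : OnePoint K → K) := by
  refine ⟨fun t ht => ?_, isHolomorphicDiskAtInfty_tateLambda⟩
  obtain ⟨n1, n2, n3, n4, n5, n6⟩ := thetaQuotient_pairwise_ne h2 ht
  have hset := setOf_sq_eq_one_tateCurve t
  have hinj : Set.InjOn (thetaQuotient (t ^ (-2 : ℤ)))
      {P : TateCurve (t ^ (-2 : ℤ)) | P ^ 2 = 1} := by
    rw [hset]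
    rintro P (rfl | rfl | rfl | rfl) Q (rfl | rfl | rfl | rfl) h <;>
      first
      | rfl
      | exact absurd h ‹_›
      | exact absurd h.symm ‹_›
  refine ⟨⟨hset, ?_⟩, ⟨_, isInversionQuotient_thetaQuotient h2 ht⟩, multipliable_lambdaFactor ht,
    fun π hπ => ?_⟩
  -- The four classes are distinct because their images under the theta quotient are.
  · have hne : ∀ {P Q : TateCurve (t ^ (-2 : ℤ))},
        thetaQuotient (t ^ (-2 : ℤ)) P ≠ thetaQuotient (t ^ (-2 : ℤ)) Q → P ≠ Q :=
      fun h => ne_of_apply_ne _ h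
    rw [hset, Set.ncard_insert_of_notMem, Set.ncard_insert_of_notMem, Set.ncard_pair (hne n6)]
    · simp only [Set.mem_insert_iff, Set.mem_singleton_iff, not_or]
      exact ⟨hne n4, hne n5⟩
    · simp only [Set.mem_insert_iff, Set.mem_singleton_iff, not_or]
      exact ⟨hne n1, hne n2, hne n3⟩
  · obtain ⟨A, B, hAB, hdeg, hπθ, hθπ⟩ := hπ.exists_ratMap h2 ht
    refine ⟨fun P hP Q hQ h => hinj hP hQ (hθπ P Q h), ?_⟩
    rw [hπθ, hπθ, hπθ, hπθ, crossRatio_ratMap hAB hdeg, crossRatio_thetaQuotient h2 ht]
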